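/- **Model.** An anonymous $n$-party network $N$ is a connected simple undirected graph on $n$ parties together with a port numbering: each party numbers its incident links by its ports, independently of the other parties. A measurement-free protocol has a fixed number of synchronous rounds. In each round every party applies a unitary to its input qubit, output qubit, finite-dimensional work register and message registers (one per port), and then the message registers at the two ends of every link are swapped. The unitary depends only on the round and on the number of ports of the party. A message register consists of finitely many cells, each of which is empty or holds a qubit, superpositions being allowed. An algorithm assigns to every $n$ such a protocol, and all $n$ parties run it ($n$ is given to every party; the topology is unknown). The initial state on input $\sum_x\alpha_x|x\rangle$, where $x\in\{0,1\}^n$ and $\sum_x|\alpha_x|^2=1$, is $\sum_x\alpha_x\bigotimes_{i=1}^n|x_i\rangle|\mathrm{true}\rangle$ with all work registers in a fixed initial state and all message registers empty. For $f\colon\{0,1\}^n\to\{\mathrm{true},\mathrm{false}\}$, a protocol *exactly computes* $f$ on $N$ if on every classical input $x$ all parties end with output $f(x)$ with certainty; the other registers may be left in any joint state. It *exactly computes $f$ for any quantum input* on $N$ if for every input $\sum_x\alpha_x|x\rangle$ the final state is $\sum_x\alpha_x\bigotimes_{i=1}^n|x_i\rangle|f(x)\rangle$ with all other registers back in their initial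 state. $Q^{\mathrm{bit}}_N$ denotes the maximum, over all quantum inputs $\sum_x\alpha_x|x\rangle$, of the number of qubits sent over all links in all rounds. Here a cell transmitted in a round counts as one qubit if it is non-empty in some basis state of non-zero amplitude. The number of rounds $Q^{\mathrm{rnd}}$ is measured in two ways: as the total number of rounds of the protocol, and as the maximum, over all quantum inputs, of the number of rounds in which a message is actually sent on $N$. Let $H_k(x)$ be true if and only if the Hamming weight of $x\in\{0,1\}^n$ is $k$. **Theorem.** There is an absolute constant $C$ such that for every algorithm $\mathcal H_0$ there is an algorithm $\mathcal H_1$ with the following properties for every $n$. The total number of rounds of $\mathcal H_1$ for $n$ parties is at most $C$ times that of $\mathcal H_0$. Moreover, on every anonymous $n$-party network $N$ on which $\mathcal H_0$ exactly computes $H_0$, the algorithm $\mathcal H_1$ exactly computes $H_1$ for any quantum input, without intermediate measurements, and the number of rounds in which messages are sent is at most $C$ times that of $\mathcal H_0$ on $N$, and $$Q^{\mathrm{bit}}_N(\mathcal H_1)\le C\,n\,Q^{\mathrm{bit}}_N(\mathcal H_0).$$ So $H_1$ is computed in $O(Q^{\mathrm{rnd}}(\mathcal H_0))$ rounds with bit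 complexity $O(n\,Q^{\mathrm{bit}}(\mathcal H_0))$. -/

import Mathlib

namespace AnonQNet

/-- An `n`-party network: a connected simple undirected graph on the parties, together with a
port numbering, that is, for every party `v` a bijection between the ports `0, …, deg v - 1` of `v`
and the links incident to `v` (given by the neighbour at the other end of the link). The port
numberings of different parties are unrelated. -/
structure Network (n : ℕ) where
  graph : SimpleGraph (Fin n)
  connected : graph.Connected
  deg : Fin n → ℕ
  port : ∀ v, Fin (deg v) ≃ graph.neighborSet v

/-- The party at the other end of the link at port `i` of party `v`. -/
def Network.neighbor {n : ℕ} (N : Network n) (v : Fin n) (i : Fin (N.deg v)) : Fin n :=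
  (N.port v i : Fin n)

/-- The port through which that party sees the same link. -/
def Network.backPort {n : ℕ} (N : Network n) (v : Fin n) (i : Fin (N.deg v)) :
    Fin (N.deg (N.neighbor v i)) :=
  (N.port (N.neighbor v i)).symm ⟨v, SimpleGraph.Adj.symm (N.port v i).2⟩

/-- Computational basis states of one party with `d` ports: the input qubit, the output qubit, a
finite-dimensional work register with basis `W`, and a message register at every port.
A message register consists of `L` cells, and a cell is empty (`none`) or holds a qubit
(`some false`, `some true`); superpositions of empty and non-empty are possible. -/
structure LocalBasis (W : Type) (L d : ℕ) : Type where
  input : Bool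
  output : Bool
  work : W
  msg : Fin d → Fin L → Option Bool
  deriving DecidableEq

/-- A local basis state as a tuple. -/
def LocalBasis.equivProd (W : Type) (L d : ℕ) :
    LocalBasis W L d ≃ (Bool × Bool) × W × (Fin d → Fin L → Option Bool) where
  toFun b := ((b.input, b.output), b.work, b.msg)
  invFun p := ⟨p.1.1, p.1.2, p.2.1, p.2.2⟩
  left_inv _ := rfl
  right_inv _ := rfl

instance LocalBasis.instFintype (W : Type) [Fintype W] (L d : ℕ) : Fintype (LocalBasis W L d) :=
  Fintype.ofEquiv _ (LocalBasis.equivProd W L d).symm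

/-- A measurement-free synchronous protocol for an anonymous quantum network. All parties run the
same protocol, and what a party does depends only on the number `d` of its ports.
`op r d` is the unitary operation that a party with `d` ports performs on its input, output, work
and message registers after `r` rounds of communication (it processes the messages received in
round `r`, if `r ≥ 1`, and prepares the messages to be sent in round `r + 1`, if `r < rounds`).
Only `op 0, …, op rounds` are used. -/
structure Protocol : Type 1 where
  /-- the number of rounds of communication -/
  rounds : ℕ
  /-- the maximal number of qubits in a message -/
  width : ℕ
  /-- the basis of the work register -/
  Work : ℕ → Type
  [instFintype : ∀ d, Fintype (Work d)]
  [instDecidableEq : ∀ d, DecidableEq (Work d)]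
  /-- the initial state of the work register -/
  blank : ∀ d, Work d
  op : ℕ → ∀ d, Matrix (LocalBasis (Work d) width d) (LocalBasis (Work d) width d) ℂ
  op_unitary : ∀ r d, op r d ∈ Matrix.unitaryGroup (LocalBasis (Work d) width d) ℂ

attribute [instance] Protocol.instFintype Protocol.instDecidableEq

/-- An algorithm for parties that are given the number `n` of parties. -/
abbrev Algorithm : Type 1 := ℕ → Protocol

variable {n : ℕ}

/-- Joint basis states of all the parties. -/
abbrev Config (P : Protocol) (N : Network n) : Type :=
  ∀ v : Fin n, LocalBasis (P.Work (N.deg v)) P.width (N.deg v)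

/-- Joint (pure) states, as vectors of amplitudes. -/
abbrev State (P : Protocol) (N : Network n) : Type := Config P N → ℂ

/-- Swap the two message registers at the ends of every link. -/
def exchangeConfig (P : Protocol) (N : Network n) (c : Config P N) : Config P N :=
  fun v => { c v with msg := fun i => (c (N.neighbor v i)).msg (N.backPort v i) }

/-- One round of communication: every message is delivered to the other end of its link
(`exchangeConfig` is an involution). -/
def exchange (P : Protocol) (N : Network n) (ψ : State P N) : State P N :=
  fun c => ψ (exchangeConfig P N c)

/-- Every party performs its local operation number `r`: the tensor product of the local
unitaries is applied to the joint state. -/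
def applyLocal (P : Protocol) (N : Network n) (r : ℕ) (ψ : State P N) : State P N :=
  fun c => ∑ c' : Config P N, (∏ v, P.op r (N.deg v) (c v) (c' v)) * ψ c'

/-- The joint state after `r` rounds of communication and the subsequent local operation. If
`r < P.rounds`, this is the state whose message registers are transmitted in round `r + 1`. -/
def stateAfter (P : Protocol) (N : Network n) (ψ : State P N) : ℕ → State P N
  | 0 => applyLocal P N 0 ψ
  | r + 1 => applyLocal P N (r + 1) (exchange P N (stateAfter P N ψ r))

/-- The joint state at the end of the protocol. -/
def finalState (P : Protocol) (N : Network n) (ψ : State P N) : State P N :=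
  stateAfter P N ψ P.rounds

/-- The basis state in which the input bits are `x`, all output bits are `y`, all work registers
are in their initial state and all message registers are empty. -/
def cleanConfig (P : Protocol) (N : Network n) (x : Fin n → Bool) (y : Bool) : Config P N :=
  fun v => ⟨x v, y, P.blank (N.deg v), fun _ _ => none⟩

/-- The state `∑ x, α x |x⟩ |f x⟩ ⋯ |f x⟩ |blank⟩`. -/
def cleanState (P : Protocol) (N : Network n) (α : (Fin n → Bool) → ℂ)
    (f : (Fin n → Bool) → Bool) : State P N :=
  ∑ x, α x • Pi.single (cleanConfig P N x (f x)) 1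

/-- The initial state on the (possibly superposed) input `∑ x, α x |x⟩`:
the output qubits are initialised to `true`. -/
def initialState (P : Protocol) (N : Network n) (α : (Fin n → Bool) → ℂ) : State P N :=
  cleanState P N α fun _ => true

/-- On every classical input `x`, each party finally holds the output `f x` with certainty.
The other registers may be left in an arbitrary (entangled) state. -/
def Computes (P : Protocol) (N : Network n) (f : (Fin n → Bool) → Bool) : Prop :=
  ∀ (x : Fin n → Bool) (c : Config P N),
    finalState P N (initialState P N (Pi.single x 1)) c ≠ 0 → ∀ v, (c v).output = f x

/-- On every superposed input, the protocol maps `∑ x, α x |x⟩ |true⟩ ⋯ |true⟩` to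
`∑ x, α x |x⟩ |f x⟩ ⋯ |f x⟩`, with all ancillas restored to their initial state. -/
def ComputesCoherently (P : Protocol) (N : Network n) (f : (Fin n → Bool) → Bool) : Prop :=
  ∀ α : (Fin n → Bool) → ℂ, ∑ x, ‖α x‖ ^ 2 = 1 →
    finalState P N (initialState P N α) = cleanState P N α f

open Classical in
/-- The message cells (sender, port of the sender, cell) that are in use when messages are
transmitted in round `r + 1`, on input `α`: those that hold a qubit in some basis state of non-zero
amplitude. So a superposition uses the union of what its branches use. -/
noncomputable def sent (P : Protocol) (N : Network n) (α : (Fin n → Bool) → ℂ) (r : ℕ) :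
    Finset (Σ v : Fin n, Fin (N.deg v) × Fin P.width) :=
  {q | ∃ c : Config P N,
    stateAfter P N (initialState P N α) r c ≠ 0 ∧ (c q.1).msg q.2.1 q.2.2 ≠ none}

/-- The number of qubits communicated over all links in all rounds, on input `α`. -/
noncomputable def bitsOn (P : Protocol) (N : Network n) (α : (Fin n → Bool) → ℂ) : ℕ :=
  ∑ r ∈ Finset.range P.rounds, (sent P N α r).card

open Classical in
/-- The number of rounds in which some message is sent, on input `α`. -/
noncomputable def activeRoundsOn (P : Protocol) (N : Network n) (α : (Fin n → Bool) → ℂ) : ℕ :=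
  ((Finset.range P.rounds).filter fun r => (sent P N α r).Nonempty).card

/-- Worst-case bit complexity on the network `N` over all quantum inputs. -/
noncomputable def bitComplexity (P : Protocol) (N : Network n) : ℕ∞ :=
  ⨆ (α : (Fin n → Bool) → ℂ) (_ : ∑ x, ‖α x‖ ^ 2 = 1), (bitsOn P N α : ℕ∞)

/-- Worst-case number of rounds with communication on the network `N` over all quantum inputs. -/
noncomputable def activeRoundComplexity (P : Protocol) (N : Network n) : ℕ∞ :=
  ⨆ (α : (Fin n → Bool) → ℂ) (_ : ∑ x, ‖α x‖ ^ 2 = 1), (activeRoundsOn P N α : ℕ∞)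

/-- `H k x` is true if and only if the Hamming weight of `x` is `k`. -/
def H (k : ℕ) (x : Fin n → Bool) : Bool :=
  decide ((Finset.univ.filter fun v => x v = true).card = k)

end AnonQNet

/-! Call a party active if its input is `true`. Suppose every active party holds a classical coin.
Two calls of `H 0`, on "active with coin `false`" and "active with coin `true`", tell which coin
values do not occur among active parties. With no active party neither value occurs. With one,
exactly one value occurs. With several, both occur unless their coins all agree. So weight one is
recognised exactly as soon as agreement of several active coins can be excluded.

It is excluded by interference. For a guessed weight `k ≥ 2`, every party prepares its coin by `U`,
one call of `H 0` multiplies by a phase `ω` the branches in which no active coin is `true`, and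
every party applies `V`. The amplitude of a branch whose active coins all equal `b` contains the
factor that `Separates` sets to zero, and `exists_separates` finds `U`, `V`, `ω` for which this
factor vanishes for both values of `b`. If the weight is exactly `k`, the active coins therefore
cannot agree (`testedCoins_eq_zero`). The weight is unknown, so all `n` guesses run in parallel on
separate coins, and weight one is accepted if every guess sees exactly one coin value
(`forall_copyResult_ne_iff`).

No garbage remains. Each parallel call of `H 0` is run, used as a control and run backwards. The
outcome is certain on the support of the coin state, so flipping the outputs does not disturb the
coins, and their preparation can be undone. In total the parallel call is run six times, forwards or
backwards, with `2 n` copies each.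

The copies run on superposed classical inputs. In a given round they may use the union of the cells
that the classical inputs use, and `exists_generic_input` charges this union to a single quantum
input of the given protocol. -/

namespace AnonQNet

open Matrix

set_option linter.unusedSectionVars false

/-! ### Tensor products of local matrices -/

section PiKronecker

variable {ι : Type*} [Fintype ι] [DecidableEq ι] {X : ι → Type*} [∀ i, Fintype (X i)]
  [∀ i, DecidableEq (X i)]

/-- The tensor product of a finite family of square matrices. -/
def piKronecker (A : ∀ i, Matrix (X i) (X i) ℂ) : Matrix (∀ i, X i) (∀ i, X i) ℂ :=
  Matrix.of fun f g => ∏ i, A i (f i) (g i)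

theorem piKronecker_apply (A : ∀ i, Matrix (X i) (X i) ℂ) (f g : ∀ i, X i) :
    piKronecker A f g = ∏ i, A i (f i) (g i) := rfl

theorem sum_prod_pi (F : ∀ i, X i → ℂ) : ∑ g : ∀ i, X i, ∏ i, F i (g i) = ∏ i, ∑ a, F i a := by
  rw [Finset.prod_univ_sum, Fintype.piFinset_univ]

theorem piKronecker_mul (A B : ∀ i, Matrix (X i) (X i) ℂ) :
    piKronecker A * piKronecker B = piKronecker fun i => A i * B i := by
  ext f g
  simp only [mul_apply, piKronecker_apply, ← Finset.prod_mul_distrib]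
  exact sum_prod_pi fun i a => A i (f i) a * B i a (g i)

theorem piKronecker_one : piKronecker (fun i => (1 : Matrix (X i) (X i) ℂ)) = 1 := by
  ext f g
  simp only [piKronecker_apply, one_apply, Finset.prod_ite_zero, Finset.prod_const_one,
    Finset.mem_univ, true_implies, funext_iff]

theorem conjTranspose_piKronecker (A : ∀ i, Matrix (X i) (X i) ℂ) :
    (piKronecker A)ᴴ = piKronecker fun i => (A i)ᴴ := by
  ext f g
  simp [piKronecker_apply, conjTranspose_apply]

theorem piKronecker_mulVec_prod (A : ∀ i, Matrix (X i) (X i) ℂ) (χ : ∀ i, X i → ℂ) (f : ∀ i, X i) :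
    (piKronecker A *ᵥ fun g => ∏ i, χ i (g i)) f = ∏ i, (A i *ᵥ χ i) (f i) := by
  simp only [mulVec, dotProduct, piKronecker_apply, ← Finset.prod_mul_distrib]
  exact sum_prod_pi fun i a => A i (f i) a * χ i a

/-- The tensor product of a finite family of unitary matrices. -/
def piUnitary (A : ∀ i, unitaryGroup (X i) ℂ) : unitaryGroup (∀ i, X i) ℂ :=
  ⟨piKronecker fun i => (A i : Matrix (X i) (X i) ℂ), by
    rw [mem_unitaryGroup_iff, star_eq_conjTranspose, conjTranspose_piKronecker, piKronecker_mul,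
      ← piKronecker_one]
    congr 1
    funext i
    exact mem_unitaryGroup_iff.1 (A i).2⟩

theorem coe_piUnitary (A : ∀ i, unitaryGroup (X i) ℂ) :
    (piUnitary A : Matrix (∀ i, X i) (∀ i, X i) ℂ) =
      piKronecker fun i => (A i : Matrix (X i) (X i) ℂ) := rfl

theorem piKronecker_smul_one_mulVec (a : ℂ) (β : (∀ i, X i) → ℂ) :
    (piKronecker fun i => a • (1 : Matrix (X i) (X i) ℂ)) *ᵥ β = a ^ Fintype.card ι • β := by
  have h : (piKronecker fun i => a • (1 : Matrix (X i) (X i) ℂ)) =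
      a ^ Fintype.card ι • piKronecker fun i => (1 : Matrix (X i) (X i) ℂ) := by
    ext f g
    simp only [piKronecker_apply, Matrix.smul_apply, smul_eq_mul, Finset.prod_mul_distrib,
      Finset.prod_const, Finset.card_univ]
  rw [h, piKronecker_one, smul_mulVec, one_mulVec]

end PiKronecker

/-! ### Controlled gates, permutations and phases -/

section BlockUnitary

variable {X E Y : Type*} [Fintype X] [DecidableEq X] [Fintype E] [DecidableEq E] [Fintype Y]
  [DecidableEq Y]

/-- The unitary matrix that applies `D y` to the first factor of `E × Y`, controlled on the second
factor `y`. -/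
def blockUnitary (loc : X ≃ E × Y) (D : Y → unitaryGroup E ℂ) : unitaryGroup X ℂ :=
  ⟨(blockDiagonal fun y => (D y : Matrix E E ℂ)).submatrix loc loc, by
    rw [mem_unitaryGroup_iff, star_eq_conjTranspose, conjTranspose_submatrix,
      blockDiagonal_conjTranspose, submatrix_mul_equiv, ← blockDiagonal_mul]
    have h : (fun y => (D y : Matrix E E ℂ) * (D y : Matrix E E ℂ)ᴴ) = 1 := by
      funext y
      exact mem_unitaryGroup_iff.1 (D y).2
    rw [h, blockDiagonal_one, submatrix_one_equiv]⟩

theorem blockUnitary_apply (loc : X ≃ E × Y) (D : Y → unitaryGroup E ℂ) (a b : X) :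
    (blockUnitary loc D : Matrix X X ℂ) a b =
      if (loc a).2 = (loc b).2 then (D (loc a).2 : Matrix E E ℂ) (loc a).1 (loc b).1 else 0 := rfl

/-- The unitary matrix of a permutation. -/
def permUnitary (σ : Equiv.Perm X) : unitaryGroup X ℂ :=
  ⟨(1 : Matrix X X ℂ).submatrix σ id, by
    rw [mem_unitaryGroup_iff, star_eq_conjTranspose, conjTranspose_submatrix, conjTranspose_one]
    ext a b
    simp [mul_apply, one_apply, eq_comm]⟩

theorem permUnitary_apply (σ : Equiv.Perm X) (a b : X) :
    (permUnitary σ : Matrix X X ℂ) a b = if σ a = b then 1 else 0 := rfl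

theorem piKronecker_permUnitary_mulVec {ι : Type*} [Fintype ι] [DecidableEq ι] (σ : Equiv.Perm X)
    (β : (ι → X) → ℂ) (f : ι → X) :
    ((piKronecker fun _ => (permUnitary σ : Matrix X X ℂ)) *ᵥ β) f = β fun i => σ (f i) := by
  simp only [mulVec, dotProduct, piKronecker_apply, permUnitary_apply, Finset.prod_ite_zero,
    Finset.prod_const_one, Finset.mem_univ, true_implies]
  rw [Finset.sum_eq_single fun i => σ (f i)]
  · simp
  · intro g _ hg
    rw [if_neg fun h => hg (funext h).symm, zero_mul]
  · simp

/-- A scalar of modulus one, as a unitary matrix. -/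
def scalarUnitary (X : Type*) [Fintype X] [DecidableEq X] (a : Circle) : unitaryGroup X ℂ :=
  ⟨(a : ℂ) • 1, by
    rw [mem_unitaryGroup_iff, star_eq_conjTranspose, conjTranspose_smul, conjTranspose_one,
      smul_mul_smul_comm, mul_one, Complex.star_def, Complex.mul_conj, Circle.normSq_coe,
      Complex.ofReal_one, one_smul]⟩

theorem coe_scalarUnitary (a : Circle) : (scalarUnitary X a : Matrix X X ℂ) = (a : ℂ) • 1 := rfl

end BlockUnitary

/-! ### States that are products conditioned on a control register -/

section ProductForm

variable {ι J E : Type*} [Fintype ι] [DecidableEq ι] [Fintype J] [DecidableEq J] [Fintype E]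
  [DecidableEq E] {X Y : ι → Type*} [∀ i, Fintype (X i)] [∀ i, DecidableEq (X i)]
  [∀ i, Fintype (Y i)] [∀ i, DecidableEq (Y i)]

/-- If every party consists of a register `E` and of `J` copies of a register, the joint states are
regrouped into the registers `E` of all parties and, for every `j`, the `j`-th copies of all
parties. -/
def regroup (loc : ∀ i, X i ≃ E × (J → Y i)) : (∀ i, X i) ≃ (ι → E) × (J → ∀ i, Y i) where
  toFun c := (fun i => (loc i (c i)).1, fun j i => (loc i (c i)).2 j)
  invFun p := fun i => (loc i).symm (p.1 i, fun j => p.2 j i)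
  left_inv c := by funext i; simp
  right_inv p := by simp

/-- The state that has amplitudes `β` on the registers `E` and, given that these hold `z`, is in
the state `Ξ z` on the copies. -/
def splitState (loc : ∀ i, X i ≃ E × (J → Y i)) (β : (ι → E) → ℂ)
    (Ξ : (ι → E) → (J → ∀ i, Y i) → ℂ) : (∀ i, X i) → ℂ :=
  fun c => β (regroup loc c).1 * Ξ (regroup loc c).1 (regroup loc c).2

/-- Gates on the registers `E`, controlled on the copies. -/
theorem piKronecker_mulVec_splitState_ext (loc : ∀ i, X i ≃ E × (J → Y i))
    (D : ∀ i, (J → Y i) → unitaryGroup E ℂ) (D' : (ι → E) → ι → Matrix E E ℂ)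
    (β : (ι → E) → ℂ) (Ξ : (ι → E) → (J → ∀ i, Y i) → ℂ)
    (hD : ∀ z y, Ξ z y ≠ 0 → ∀ i, (D i fun j => y j i : Matrix E E ℂ) = D' z i)
    (hΞ : ∀ z z' (y : J → ∀ i, Y i),
      (∀ i, (D i fun j => y j i : Matrix E E ℂ) (z i) (z' i) ≠ 0) → Ξ z' y = Ξ z y) :
    (piKronecker fun i => (blockUnitary (loc i) (D i) : Matrix (X i) (X i) ℂ)) *ᵥ
        splitState loc β Ξ =
      splitState loc (fun z => (piKronecker (D' z) *ᵥ β) z) Ξ := by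
  funext c
  obtain ⟨⟨z, y⟩, rfl⟩ := (regroup loc).symm.surjective c
  simp only [mulVec, dotProduct, splitState, Equiv.apply_symm_apply]
  rw [← (regroup loc).symm.sum_comp, Fintype.sum_prod_type, Finset.sum_mul]
  refine Finset.sum_congr rfl fun z' _ => ?_
  rw [Finset.sum_eq_single y]
  · simp only [piKronecker_apply, blockUnitary_apply, Equiv.apply_symm_apply]
    simp only [regroup, Equiv.coe_fn_symm_mk, Equiv.apply_symm_apply, if_true]
    -- If all matrix entries are nonzero, `hΞ` exchanges `z'` for `z` in the state of the copies.
    -- Otherwise both products contain a zero factor, or the state of the copies vanishes.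
    by_cases h : ∀ i, (D i fun j => y j i : Matrix E E ℂ) (z i) (z' i) ≠ 0
    · rw [hΞ z z' y h]
      by_cases h0 : Ξ z y = 0
      · simp [h0]
      · simp only [hD z y h0, mul_assoc]
    · push Not at h
      obtain ⟨i, hi⟩ := h
      rw [Finset.prod_eq_zero (Finset.mem_univ i) hi]
      by_cases h0 : Ξ z y = 0
      · simp [h0]
      · rw [Finset.prod_eq_zero (Finset.mem_univ i) (by rw [← hD z y h0 i]; exact hi)]
        simp
  · intro y' _ hy'
    simp only [piKronecker_apply, blockUnitary_apply]
    simp only [regroup, Equiv.coe_fn_symm_mk, Equiv.apply_symm_apply]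
    have : ∃ i, (fun j => y j i) ≠ fun j => y' j i := by
      by_contra! h
      exact hy' (funext fun j => funext fun i => (congrFun (h i) j).symm)
    obtain ⟨i, hi⟩ := this
    rw [Finset.prod_eq_zero (Finset.mem_univ i) (if_neg hi), zero_mul]
  · simp

/-- Gates on the copies, controlled on the registers `E`. -/
theorem piKronecker_mulVec_splitState_copies (loc : ∀ i, X i ≃ E × (J → Y i))
    (B : ∀ i, E → J → unitaryGroup (Y i) ℂ) (β : (ι → E) → ℂ) (χ : J → (ι → E) → (∀ i, Y i) → ℂ) :
    (piKronecker fun i => (blockUnitary ((loc i).trans (Equiv.prodComm _ _))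
        fun e => piUnitary (B i e) : Matrix (X i) (X i) ℂ)) *ᵥ
        splitState loc β (fun z y => ∏ j, χ j z (y j)) =
      splitState loc β (fun z y => ∏ j,
        ((piKronecker fun i => (B i (z i) j : Matrix (Y i) (Y i) ℂ)) *ᵥ χ j z) (y j)) := by
  funext c
  obtain ⟨⟨z, y⟩, rfl⟩ := (regroup loc).symm.surjective c
  simp only [splitState, Equiv.apply_symm_apply]
  rw [← piKronecker_mulVec_prod]
  simp only [mulVec, dotProduct]
  rw [← (regroup loc).symm.sum_comp, Fintype.sum_prod_type, Finset.sum_eq_single z]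
  · rw [Finset.mul_sum]
    refine Finset.sum_congr rfl fun y' _ => ?_
    simp only [splitState, Equiv.apply_symm_apply]
    simp only [piKronecker_apply, blockUnitary_apply, coe_piUnitary]
    simp only [regroup, Equiv.coe_fn_symm_mk, Equiv.apply_symm_apply, if_true, Equiv.trans_apply,
      Equiv.prodComm_apply, Prod.swap]
    rw [Finset.prod_comm]
    ring
  · intro z' _ hz'
    refine Finset.sum_eq_zero fun y' _ => ?_
    simp only [piKronecker_apply, blockUnitary_apply]
    simp only [regroup, Equiv.coe_fn_symm_mk, Equiv.apply_symm_apply, Equiv.trans_apply,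
      Equiv.prodComm_apply, Prod.swap]
    obtain ⟨i, hi⟩ := Function.ne_iff.1 hz'
    rw [Finset.prod_eq_zero (Finset.mem_univ i) (if_neg hi.symm), zero_mul]
  · simp

end ProductForm

/-! ### Composing, reversing and conjugating schedules -/

/-- A sequence of local operations, with communication between consecutive ones. -/
structure Schedule (G : Type*) where
  rounds : ℕ
  op : ℕ → G

namespace Schedule

variable {G V : Type*} [Group G] [AddCommGroup V] [Module ℂ V]

/-- A single local operation without communication. -/
def gate (g : G) : Schedule G := ⟨0, fun _ => g⟩

/-- Two schedules one after the other. -/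
def seq (S S' : Schedule G) : Schedule G where
  rounds := S.rounds + S'.rounds
  op r := if r < S.rounds then S.op r else if r = S.rounds then S'.op 0 * S.op r
    else S'.op (r - S.rounds)

/-- The schedule run backwards. -/
def rev (S : Schedule G) : Schedule G where
  rounds := S.rounds
  op r := (S.op (S.rounds - r))⁻¹

/-- The operation `g`, conjugated by the schedule `S`. -/
def call (S : Schedule G) (g : G) : Schedule G := S.seq ((gate g).seq S.rev)

variable (ρ : G →* Module.End ℂ V) (e : Module.End ℂ V)

/-- The state after `r` rounds of communication, each given by `e`, and the subsequent operation. -/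
def run (S : Schedule G) (ψ : V) : ℕ → V
  | 0 => ρ (S.op 0) ψ
  | r + 1 => ρ (S.op (r + 1)) (e (run S ψ r))

/-- The state at the end of the schedule. -/
def final (S : Schedule G) (ψ : V) : V := S.run ρ e ψ S.rounds

/-- The sum of the costs `w` of all rounds of communication. -/
def cost (w : V → ℕ) (S : Schedule G) (ψ : V) : ℕ := ∑ r ∈ Finset.range S.rounds, w (S.run ρ e ψ r)

theorem exists_run_eq (S : Schedule G) (r : ℕ) :
    ∃ R : Module.End ℂ V, ∀ ψ, S.run ρ e ψ r = R ψ := by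
  induction r with
  | zero => exact ⟨ρ (S.op 0), fun _ => rfl⟩
  | succ r ih =>
    obtain ⟨R, hR⟩ := ih
    exact ⟨ρ (S.op (r + 1)) * e * R, fun ψ => by rw [run, hR]; rfl⟩

theorem final_gate (g : G) (ψ : V) : (gate g).final ρ e ψ = ρ g ψ := rfl

theorem cost_gate (w : V → ℕ) (g : G) (ψ : V) : (gate g).cost ρ e w ψ = 0 := by simp [cost, gate]

theorem run_seq_of_lt (S S' : Schedule G) (ψ : V) {r : ℕ} (hr : r < S.rounds) :
    (S.seq S').run ρ e ψ r = S.run ρ e ψ r := by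
  induction r with
  | zero => simp [run, seq, hr]
  | succ r ih => rw [run, run, ih (by omega)]; simp [seq, hr]

theorem run_seq_add (S S' : Schedule G) (ψ : V) (r : ℕ) :
    (S.seq S').run ρ e ψ (S.rounds + r) = S'.run ρ e (S.final ρ e ψ) r := by
  induction r with
  | zero =>
    rw [add_zero, final]
    have hop : (S.seq S').op S.rounds = S'.op 0 * S.op S.rounds := by simp [seq]
    have key : ∀ k, k = S.rounds → (S.seq S').run ρ e ψ k = ρ (S'.op 0) (S.run ρ e ψ k) := by
      intro k hk
      cases k with
      | zero =>
        rw [← hk] at hop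
        rw [run, run, hop, map_mul]; rfl
      | succ k =>
        rw [run, run, run_seq_of_lt ρ e S S' ψ (by omega), hk, hop, map_mul]; rfl
    exact key _ rfl
  | succ r ih =>
    rw [← add_assoc, run, ih, run]
    congr 2
    simp [seq, add_assoc]

theorem final_seq (S S' : Schedule G) (ψ : V) :
    (S.seq S').final ρ e ψ = S'.final ρ e (S.final ρ e ψ) :=
  run_seq_add ρ e S S' ψ S'.rounds

theorem cost_seq (w : V → ℕ) (S S' : Schedule G) (ψ : V) :
    (S.seq S').cost ρ e w ψ = S.cost ρ e w ψ + S'.cost ρ e w (S.final ρ e ψ) := by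
  simp only [cost]
  rw [show (S.seq S').rounds = S.rounds + S'.rounds from rfl, Finset.sum_range_add]
  congr 1
  · exact Finset.sum_congr rfl fun r hr => by
      rw [run_seq_of_lt ρ e S S' ψ (Finset.mem_range.1 hr)]
  · exact Finset.sum_congr rfl fun r _ => by rw [run_seq_add]

variable {e}

theorem rho_inv_apply (g : G) (ψ : V) : ρ g⁻¹ (ρ g ψ) = ψ := by
  rw [← Module.End.mul_apply, ← map_mul, inv_mul_cancel, map_one, Module.End.one_apply]

/-- Communication is its own inverse, so the reversed schedule retraces the original one. What it is
about to send is what the original had just received, hence the extra `e`; the costs agree only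
because `w` is invariant under `e`. -/
theorem run_rev (he : ∀ ψ, e (e ψ) = ψ) (S : Schedule G) (ψ : V) {r : ℕ} (hr : r < S.rounds) :
    S.rev.run ρ e (S.final ρ e ψ) r = e (S.run ρ e ψ (S.rounds - 1 - r)) := by
  induction r with
  | zero =>
    obtain ⟨k, hk⟩ : ∃ k, S.rounds = k + 1 := ⟨S.rounds - 1, by omega⟩
    simp [run, rev, final, hk]
  | succ r ih =>
    rw [run, ih (by omega), he]
    obtain ⟨k, hk⟩ : ∃ k, S.rounds - 1 - r = k + 1 := ⟨S.rounds - 1 - r - 1, by omega⟩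
    have h1 : S.rounds - (r + 1) = k + 1 := by omega
    have h2 : S.rounds - 1 - (r + 1) = k := by omega
    simp only [rev, h1, h2, hk, run, rho_inv_apply]

theorem final_rev (he : ∀ ψ, e (e ψ) = ψ) (S : Schedule G) (ψ : V) :
    S.rev.final ρ e (S.final ρ e ψ) = ψ := by
  rw [final, show S.rev.rounds = S.rounds from rfl]
  obtain hk | ⟨k, hk⟩ : S.rounds = 0 ∨ ∃ k, S.rounds = k + 1 := by
    cases S.rounds <;> simp
  · simp [run, rev, final, hk]
  · have h : S.rounds - 1 - k = 0 := by omega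
    rw [hk, run, run_rev ρ he S ψ (by omega), h, he]
    simp [rev, hk, run]

theorem cost_rev (he : ∀ ψ, e (e ψ) = ψ) (w : V → ℕ) (hw : ∀ ψ, w (e ψ) = w ψ) (S : Schedule G)
    (ψ : V) : S.rev.cost ρ e w (S.final ρ e ψ) = S.cost ρ e w ψ := by
  simp only [cost]
  rw [← Finset.sum_range_reflect]
  refine Finset.sum_congr rfl fun r hr => ?_
  have hr' : r < S.rounds := Finset.mem_range.1 hr
  rw [show S.rev.rounds = S.rounds from rfl, run_rev ρ he S ψ (by omega), hw]
  congr 2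
  omega

/-- This is uncomputation: if `g` turns the computed state into the computed state of another start,
then running backwards arrives at that start without garbage. -/
theorem final_call (he : ∀ ψ, e (e ψ) = ψ) (S : Schedule G) (g : G) {ψ ψ' : V}
    (h : ρ g (S.final ρ e ψ) = S.final ρ e ψ') : (S.call g).final ρ e ψ = ψ' := by
  rw [call, final_seq, final_seq, final_gate, h, final_rev ρ he]

theorem cost_call (he : ∀ ψ, e (e ψ) = ψ) (w : V → ℕ) (hw : ∀ ψ, w (e ψ) = w ψ) (S : Schedule G)
    (g : G) {ψ ψ' : V} (h : ρ g (S.final ρ e ψ) = S.final ρ e ψ') :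
    (S.call g).cost ρ e w ψ = S.cost ρ e w ψ + S.cost ρ e w ψ' := by
  rw [call, cost_seq, cost_seq, final_gate, cost_gate, zero_add, h, cost_rev ρ he w hw]

end Schedule

/-! ### Joint states, communication and costs on a network -/

variable {n : ℕ}

/-- The link at a port, seen from its other end. -/
def Network.swapLink (N : Network n) (p : Σ v, Fin (N.deg v)) : Σ v, Fin (N.deg v) :=
  ⟨N.neighbor p.1 p.2, N.backPort p.1 p.2⟩

theorem Network.swapLink_swapLink (N : Network n) (p : Σ v, Fin (N.deg v)) :
    N.swapLink (N.swapLink p) = p := by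
  -- The graph is simple, so a port is determined by its party and the neighbour behind it.
  have key : ∀ p q : Σ v, Fin (N.deg v), p.1 = q.1 → N.neighbor p.1 p.2 = N.neighbor q.1 q.2 →
      p = q := by
    rintro ⟨v, i⟩ ⟨w, j⟩ h1 h2
    obtain rfl : v = w := h1
    congr 1
    exact (N.port v).injective (Subtype.ext h2)
  have h : ∀ p : Σ v, Fin (N.deg v),
      N.neighbor (N.swapLink p).1 (N.swapLink p).2 = p.1 := by
    rintro ⟨v, i⟩
    simp only [swapLink, neighbor, backPort]
    exact congrArg Subtype.val (Equiv.apply_symm_apply _ _)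
  exact key _ _ (h p) (h (N.swapLink p))

/-- The local unitaries of the parties, one for every number of ports. -/
abbrev LocalGates (P : Protocol) : Type :=
  ∀ d, unitaryGroup (LocalBasis (P.Work d) P.width d) ℂ

/-- The action of the local unitaries on joint states. -/
noncomputable def tensorRep (P : Protocol) (N : Network n) :
    LocalGates P →* Module.End ℂ (State P N) where
  toFun g := Matrix.toLin' (piKronecker fun v =>
    (g (N.deg v) : Matrix (LocalBasis (P.Work (N.deg v)) P.width (N.deg v)) _ ℂ))
  map_one' := by
    rw [Module.End.one_eq_id, ← Matrix.toLin'_one, ← piKronecker_one]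
    rfl
  map_mul' g h := by
    rw [Module.End.mul_eq_comp, ← Matrix.toLin'_mul, piKronecker_mul]
    rfl

theorem tensorRep_apply (P : Protocol) (N : Network n) (g : LocalGates P) (ψ : State P N) :
    tensorRep P N g ψ = (piKronecker fun v =>
      (g (N.deg v) : Matrix (LocalBasis (P.Work (N.deg v)) P.width (N.deg v)) _ ℂ)) *ᵥ ψ := by
  simp [tensorRep]

/-- The communication of one round as a linear map. -/
def exchangeEnd (P : Protocol) (N : Network n) : Module.End ℂ (State P N) where
  toFun := exchange P N
  map_add' _ _ := rfl
  map_smul' _ _ := rfl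

theorem exchangeEnd_apply (P : Protocol) (N : Network n) (ψ : State P N) (c : Config P N) :
    exchangeEnd P N ψ c = ψ (exchangeConfig P N c) := rfl

theorem exchangeConfig_exchangeConfig (P : Protocol) (N : Network n) (c : Config P N) :
    exchangeConfig P N (exchangeConfig P N c) = c := by
  funext v
  have h : ∀ i, (c (N.swapLink (N.swapLink ⟨v, i⟩)).1).msg (N.swapLink (N.swapLink ⟨v, i⟩)).2 =
      (c v).msg i := fun i => by rw [N.swapLink_swapLink]
  have h' : (exchangeConfig P N (exchangeConfig P N c) v).msg = (c v).msg := funext h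
  have e : exchangeConfig P N (exchangeConfig P N c) v =
      { c v with msg := (exchangeConfig P N (exchangeConfig P N c) v).msg } := rfl
  rw [e, h']

theorem exchangeEnd_exchangeEnd (P : Protocol) (N : Network n) (ψ : State P N) :
    exchangeEnd P N (exchangeEnd P N ψ) = ψ := by
  funext c
  rw [exchangeEnd_apply, exchangeEnd_apply, exchangeConfig_exchangeConfig]

/-- The operations of a protocol. -/
def Protocol.schedule (P : Protocol) : Schedule (LocalGates P) :=
  ⟨P.rounds, fun r d => ⟨P.op r d, P.op_unitary r d⟩⟩

/-- The protocol with the registers of `P` and the operations of `S`. -/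
@[reducible] def Protocol.withSchedule (P : Protocol) (S : Schedule (LocalGates P)) : Protocol :=
  { P with
    rounds := S.rounds
    op := fun r d => S.op r d
    op_unitary := fun r d => (S.op r d).2 }

theorem stateAfter_eq_run (P : Protocol) (N : Network n) (ψ : State P N) (r : ℕ) :
    stateAfter P N ψ r = P.schedule.run (tensorRep P N) (exchangeEnd P N) ψ r := by
  induction r with
  | zero => rw [Schedule.run, tensorRep_apply]; rfl
  | succ r ih => rw [Schedule.run, tensorRep_apply, ← ih]; rfl

theorem stateAfter_withSchedule (P : Protocol) (S : Schedule (LocalGates P)) (N : Network n)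
    (ψ : State P N) (r : ℕ) :
    stateAfter (P.withSchedule S) N ψ r = S.run (tensorRep P N) (exchangeEnd P N) ψ r :=
  stateAfter_eq_run (P.withSchedule S) N ψ r

theorem finalState_withSchedule (P : Protocol) (S : Schedule (LocalGates P)) (N : Network n)
    (ψ : State P N) :
    finalState (P.withSchedule S) N ψ = S.final (tensorRep P N) (exchangeEnd P N) ψ :=
  stateAfter_withSchedule P S N ψ S.rounds

open Classical in
/-- The message cells that hold a qubit in some basis state of non-zero amplitude. -/
noncomputable def usedCells (P : Protocol) (N : Network n) (ψ : State P N) :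
    Finset (Σ v : Fin n, Fin (N.deg v) × Fin P.width) :=
  {q | ∃ c : Config P N, ψ c ≠ 0 ∧ (c q.1).msg q.2.1 q.2.2 ≠ none}

theorem mem_usedCells {P : Protocol} {N : Network n} {ψ : State P N}
    {q : Σ v : Fin n, Fin (N.deg v) × Fin P.width} :
    q ∈ usedCells P N ψ ↔ ∃ c : Config P N, ψ c ≠ 0 ∧ (c q.1).msg q.2.1 q.2.2 ≠ none := by
  simp [usedCells]

theorem sent_eq_usedCells (P : Protocol) (N : Network n) (α : (Fin n → Bool) → ℂ) (r : ℕ) :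
    sent P N α r = usedCells P N (stateAfter P N (initialState P N α) r) := rfl

/-- The message cell at the other end of the link. -/
def Network.swapCell (N : Network n) (L : ℕ) (q : Σ v : Fin n, Fin (N.deg v) × Fin L) :
    Σ v : Fin n, Fin (N.deg v) × Fin L :=
  ⟨N.neighbor q.1 q.2.1, N.backPort q.1 q.2.1, q.2.2⟩

theorem Network.swapCell_swapCell (N : Network n) (L : ℕ)
    (q : Σ v : Fin n, Fin (N.deg v) × Fin L) : N.swapCell L (N.swapCell L q) = q := by
  have h := congrArg (fun p : Σ v, Fin (N.deg v) =>
    (⟨p.1, p.2, q.2.2⟩ : Σ v : Fin n, Fin (N.deg v) × Fin L)) (N.swapLink_swapLink ⟨q.1, q.2.1⟩)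
  exact h

theorem card_usedCells_exchangeEnd (P : Protocol) (N : Network n) (ψ : State P N) :
    (usedCells P N (exchangeEnd P N ψ)).card = (usedCells P N ψ).card := by
  have key : ∀ q, q ∈ usedCells P N (exchangeEnd P N ψ) ↔
      N.swapCell P.width q ∈ usedCells P N ψ := by
    intro q
    rw [mem_usedCells, mem_usedCells]
    constructor
    · rintro ⟨c, hc, hq⟩
      refine ⟨exchangeConfig P N c, hc, ?_⟩
      change (exchangeConfig P N (exchangeConfig P N c) q.1).msg q.2.1 q.2.2 ≠ none
      rwa [exchangeConfig_exchangeConfig]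
    · rintro ⟨c, hc, hq⟩
      refine ⟨exchangeConfig P N c, ?_, hq⟩
      rwa [exchangeEnd_apply, exchangeConfig_exchangeConfig]
  refine Finset.card_nbij' (N.swapCell P.width) (N.swapCell P.width) (fun q hq => (key q).1 hq)
    (fun q hq => (key _).2 ?_) (fun q _ => N.swapCell_swapCell _ q)
    (fun q _ => N.swapCell_swapCell _ q)
  rwa [N.swapCell_swapCell]

/-- The number of message cells in use. -/
noncomputable def bitCost (P : Protocol) (N : Network n) (ψ : State P N) : ℕ :=
  (usedCells P N ψ).card

/-- `1` if some message cell is in use, and `0` otherwise. -/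
noncomputable def roundCost (P : Protocol) (N : Network n) (ψ : State P N) : ℕ :=
  min 1 (usedCells P N ψ).card

theorem bitCost_exchangeEnd (P : Protocol) (N : Network n) (ψ : State P N) :
    bitCost P N (exchangeEnd P N ψ) = bitCost P N ψ := card_usedCells_exchangeEnd P N ψ

theorem roundCost_exchangeEnd (P : Protocol) (N : Network n) (ψ : State P N) :
    roundCost P N (exchangeEnd P N ψ) = roundCost P N ψ := by
  rw [roundCost, roundCost, card_usedCells_exchangeEnd]

theorem bitsOn_eq_cost (P : Protocol) (N : Network n) (α : (Fin n → Bool) → ℂ) :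
    bitsOn P N α = P.schedule.cost (tensorRep P N) (exchangeEnd P N) (bitCost P N)
      (initialState P N α) :=
  Finset.sum_congr rfl fun r _ => by rw [sent_eq_usedCells, stateAfter_eq_run, bitCost]

theorem activeRoundsOn_eq_cost (P : Protocol) (N : Network n) (α : (Fin n → Bool) → ℂ) :
    activeRoundsOn P N α = P.schedule.cost (tensorRep P N) (exchangeEnd P N) (roundCost P N)
      (initialState P N α) := by
  rw [activeRoundsOn, Finset.card_filter]
  refine Finset.sum_congr rfl fun r _ => ?_
  rw [roundCost, ← stateAfter_eq_run, ← sent_eq_usedCells]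
  split_ifs with h
  · have := h.card_pos
    omega
  · rw [Finset.not_nonempty_iff_eq_empty.1 h]
    simp

theorem initialState_apply (P : Protocol) (N : Network n) (α : (Fin n → Bool) → ℂ) :
    initialState P N α = ∑ x, α x • Pi.single (cleanConfig P N x true) 1 := rfl

theorem initialState_single (P : Protocol) (N : Network n) (x : Fin n → Bool) :
    initialState P N (Pi.single x 1) = Pi.single (cleanConfig P N x true) 1 := by
  rw [initialState_apply, Finset.sum_eq_single x]
  · simp
  · intro y _ hy
    simp [hy]
  · simp

theorem exists_linearMap_stateAfter (P : Protocol) (N : Network n) (r : ℕ) :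
    ∃ Λ : ((Fin n → Bool) → ℂ) →ₗ[ℂ] State P N, ∀ α,
      stateAfter P N (initialState P N α) r = Λ α := by
  obtain ⟨R, hR⟩ := P.schedule.exists_run_eq (tensorRep P N) (exchangeEnd P N) r
  refine ⟨R ∘ₗ Fintype.linearCombination ℂ fun x => Pi.single (cleanConfig P N x true) 1,
    fun α => ?_⟩
  rw [stateAfter_eq_run, hR]
  rfl

/-- Some superposed input uses in every round all the message cells that some classical input
uses. -/
theorem exists_generic_input (P : Protocol) (N : Network n) :
    ∃ α : (Fin n → Bool) → ℂ, ∑ x, ‖α x‖ ^ 2 = 1 ∧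
      ∀ r < P.rounds, ∀ x, sent P N (Pi.single x 1) r ⊆ sent P N α r := by
  choose Λ hΛ using exists_linearMap_stateAfter P N
  -- Each amplitude in each round is a linear functional of the input. Over an infinite field some
  -- vector avoids the kernels of finitely many nonzero functionals.
  let f : Fin P.rounds × Config P N → Module.Dual ℂ ((Fin n → Bool) → ℂ) := fun p =>
    LinearMap.proj p.2 ∘ₗ Λ p.1
  -- The additional functional `none` ensures `α ≠ 0`, so that `α` can be normalised.
  let g : Option {p : Fin P.rounds × Config P N // ∃ α, f p α ≠ 0} →
      Module.Dual ℂ ((Fin n → Bool) → ℂ) := fun o =>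
    o.elim (LinearMap.proj fun _ => false) fun p => f p.1
  obtain ⟨α, hα⟩ := Module.Dual.exists_forall_ne_zero_of_forall_exists g (by
    rintro (_ | p)
    · exact ⟨fun _ => 1, one_ne_zero⟩
    · exact p.2)
  have hpos : 0 < ∑ x, ‖α x‖ ^ 2 :=
    Finset.sum_pos' (fun _ _ => by positivity)
      ⟨fun _ => false, Finset.mem_univ _, by have := norm_pos_iff.2 (hα none); positivity⟩
  set t : ℝ := (√(∑ x, ‖α x‖ ^ 2))⁻¹ with ht
  have ht0 : (t : ℂ) ≠ 0 := by
    rw [Complex.ofReal_ne_zero]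
    positivity
  refine ⟨(t : ℂ) • α, ?_, fun r hr x q hq => ?_⟩
  · simp only [Pi.smul_apply, smul_eq_mul, norm_mul, mul_pow, ← Finset.mul_sum, Complex.norm_real,
      Real.norm_eq_abs, sq_abs]
    rw [ht, inv_pow, Real.sq_sqrt hpos.le, inv_mul_cancel₀ hpos.ne']
  · rw [sent_eq_usedCells, mem_usedCells] at hq ⊢
    obtain ⟨c, hc, hq⟩ := hq
    refine ⟨c, ?_, hq⟩
    rw [hΛ] at hc ⊢
    have h := hα (some ⟨(⟨r, hr⟩, c), _, hc⟩)
    rw [map_smul]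
    exact mul_ne_zero ht0 h

/-! ### Parallel copies of the given protocol, controlled by the coins -/

section Parallel

variable (P : Protocol) (K : Type) [Fintype K] [DecidableEq K]

/-- The basis of the registers that a party uses besides the copies of another protocol: coins,
the input qubit and the output qubit. -/
abbrev MainBasis (K : Type) : Type := (K → Bool) × Bool × Bool

/-- The registers of a protocol that runs `P` in parallel, one copy for every `j : K × Bool`, and
has a coin for every `k : K`. -/
@[reducible] noncomputable def parallelRegisters : Protocol where
  rounds := 0
  width := Fintype.card ((K × Bool) × Fin P.width)
  Work d := (K → Bool) × (K × Bool → (Bool × Bool) × P.Work d)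
  blank d := (fun _ => false, fun _ => ((false, true), P.blank d))
  op _ _ := 1
  op_unitary _ _ := one_mem _

/-- The message cells of the parallel copies. -/
noncomputable def cellEquiv :
    (K × Bool) × Fin P.width ≃ Fin (Fintype.card ((K × Bool) × Fin P.width)) :=
  Fintype.equivFin _

/-- The local basis states in terms of those of the copies. -/
noncomputable def localEquiv (d : ℕ) :
    LocalBasis ((parallelRegisters P K).Work d) (parallelRegisters P K).width d ≃
      MainBasis K × (K × Bool → LocalBasis (P.Work d) P.width d) where
  toFun b := ((b.work.1, b.input, b.output), fun j =>
    ⟨(b.work.2 j).1.1, (b.work.2 j).1.2, (b.work.2 j).2, fun i l => b.msg i (cellEquiv P K (j, l))⟩)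
  invFun p := ⟨p.1.2.1, p.1.2.2, (p.1.1, fun j => (((p.2 j).input, (p.2 j).output), (p.2 j).work)),
    fun i m => (p.2 ((cellEquiv P K).symm m).1).msg i ((cellEquiv P K).symm m).2⟩
  left_inv b := by simp
  right_inv p := by simp

/-- The joint basis states in terms of those of the copies. -/
noncomputable abbrev configEquiv (N : Network n) :
    Config (parallelRegisters P K) N ≃
      (Fin n → MainBasis K) × (K × Bool → Config P N) :=
  regroup fun v => localEquiv P K (N.deg v)

/-- The state with amplitudes `β` on the main registers such that, given `z` there, copy `j` is in
the state `χ j z`. -/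
noncomputable def parallelState (N : Network n) (β : (Fin n → MainBasis K) → ℂ)
    (χ : K × Bool → (Fin n → MainBasis K) → State P N) : State (parallelRegisters P K) N :=
  splitState (fun v => localEquiv P K (N.deg v)) β fun z y => ∏ j, χ j z (y j)

theorem exchangeEnd_parallelState (N : Network n) (β : (Fin n → MainBasis K) → ℂ)
    (χ : K × Bool → (Fin n → MainBasis K) → State P N) :
    exchangeEnd (parallelRegisters P K) N (parallelState P K N β χ) =
      parallelState P K N β fun j z => exchangeEnd P N (χ j z) := rfl

/-- A gate on the copies, controlled on the main registers. -/
noncomputable def copyGate (B : MainBasis K → K × Bool → LocalGates P) :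
    LocalGates (parallelRegisters P K) := fun d =>
  blockUnitary ((localEquiv P K d).trans (Equiv.prodComm _ _)) fun e => piUnitary fun j => B e j d

/-- A gate on the main registers, controlled on the outputs of the copies. -/
noncomputable def mainGate (D : (K × Bool → Bool) → unitaryGroup (MainBasis K) ℂ) :
    LocalGates (parallelRegisters P K) := fun d =>
  blockUnitary (localEquiv P K d) fun y => D fun j => (y j).output

theorem tensorRep_copyGate (N : Network n) (B : MainBasis K → K × Bool → LocalGates P)
    (β : (Fin n → MainBasis K) → ℂ) (χ : K × Bool → (Fin n → MainBasis K) → State P N) :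
    tensorRep (parallelRegisters P K) N (copyGate P K B) (parallelState P K N β χ) =
      parallelState P K N β fun j z => (piKronecker fun v =>
        (B (z v) j (N.deg v) : Matrix (LocalBasis (P.Work (N.deg v)) P.width (N.deg v)) _ ℂ)) *ᵥ
          χ j z := by
  rw [tensorRep_apply]
  exact piKronecker_mulVec_splitState_copies (fun v => localEquiv P K (N.deg v))
    (fun v e j => B e j (N.deg v)) β χ

variable {K} in
/-- The input of copy `(k, b)`: it is `true` for the parties that have input `true` and coin `b`. -/
def copyInput (j : K × Bool) (e : MainBasis K) : Bool := e.2.1 && (e.1 j.1 == j.2)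

variable {K} in
/-- The result that copy `j` is to compute. -/
def copyResult (z : Fin n → MainBasis K) (j : K × Bool) : Bool := H 0 fun v => copyInput j (z v)

/-- The permutation of the basis states of a party that negates the input. -/
def flipInput (W : Type) (L d : ℕ) : Equiv.Perm (LocalBasis W L d) where
  toFun b := { b with input := !b.input }
  invFun b := { b with input := !b.input }
  left_inv b := by simp
  right_inv b := by simp

/-- The gate that prepares the inputs of the copies. -/
noncomputable def loadGate : LocalGates (parallelRegisters P K) :=
  copyGate P K fun e j _ => if copyInput j e then permUnitary (flipInput _ _ _) else 1

/-- All copies of `P`, run in parallel on the inputs `copyInput`. -/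
noncomputable def forward : Schedule (LocalGates (parallelRegisters P K)) :=
  (Schedule.gate (loadGate P K)).seq
    ⟨P.rounds, fun r => copyGate P K fun _ _ => P.schedule.op r⟩

/-- The state with amplitudes `β` on the main registers and clean copies. -/
noncomputable def idleState (N : Network n) (β : (Fin n → MainBasis K) → ℂ) :
    State (parallelRegisters P K) N :=
  parallelState P K N β fun _ _ => Pi.single (cleanConfig P N (fun _ => false) true) 1

variable {K} in
/-- The state of copy `j` after `r` rounds of communication. -/
noncomputable def copyState (N : Network n) (r : ℕ) (j : K × Bool) (z : Fin n → MainBasis K) :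
    State P N :=
  stateAfter P N (initialState P N (Pi.single (fun v => copyInput j (z v)) 1)) r

theorem tensorRep_loadGate (N : Network n) (β : (Fin n → MainBasis K) → ℂ) :
    tensorRep (parallelRegisters P K) N (loadGate P K) (idleState P K N β) =
      parallelState P K N β fun j z =>
        initialState P N (Pi.single (fun v => copyInput j (z v)) 1) := by
  rw [loadGate, idleState, tensorRep_copyGate]
  congr 1
  funext j z c
  rw [initialState_single, mulVec_single_one, col_apply, piKronecker_apply, Pi.single_apply]
  have key : ∀ v, ((if copyInput j (z v) = true then permUnitary (flipInput _ _ _) else 1 :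
        unitaryGroup (LocalBasis (P.Work (N.deg v)) P.width (N.deg v)) ℂ) :
        Matrix (LocalBasis (P.Work (N.deg v)) P.width (N.deg v)) _ ℂ) (c v)
        (cleanConfig P N (fun _ => false) true v) =
      if c v = cleanConfig P N (fun v => copyInput j (z v)) true v then 1 else 0 := by
    intro v
    split_ifs with h1 h2 h2
    · rw [permUnitary_apply, h2]
      simp [flipInput, cleanConfig, h1]
    · rw [permUnitary_apply, if_neg]
      intro h
      apply h2
      rw [← (flipInput _ _ _).injective.eq_iff, h]
      simp [flipInput, cleanConfig, h1]
    · rw [h2]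
      simp [cleanConfig, h1]
    · refine Matrix.one_apply_ne fun h => h2 ?_
      rw [h]
      simp [cleanConfig, h1]
  rw [Finset.prod_congr rfl fun v _ => key v, Finset.prod_ite_zero, Finset.prod_const_one]
  simp only [Finset.mem_univ, true_implies, funext_iff]

theorem run_parallel (N : Network n) (β : (Fin n → MainBasis K) → ℂ) (r : ℕ) :
    (⟨P.rounds, fun r => copyGate P K fun _ _ => P.schedule.op r⟩ :
      Schedule (LocalGates (parallelRegisters P K))).run (tensorRep _ N) (exchangeEnd _ N)
      (parallelState P K N β fun j z =>
        initialState P N (Pi.single (fun v => copyInput j (z v)) 1)) r =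
      parallelState P K N β (copyState P N r) := by
  induction r with
  | zero => rw [Schedule.run, tensorRep_copyGate]; rfl
  | succ r ih =>
    rw [Schedule.run, ih, exchangeEnd_parallelState, tensorRep_copyGate]; rfl

theorem final_forward (N : Network n) (β : (Fin n → MainBasis K) → ℂ) :
    (forward P K).final (tensorRep _ N) (exchangeEnd _ N) (idleState P K N β) =
      parallelState P K N β (copyState P N P.rounds) := by
  rw [forward, Schedule.final_seq, Schedule.final_gate, tensorRep_loadGate]
  exact run_parallel P K N β P.rounds

theorem cost_forward (N : Network n) (β : (Fin n → MainBasis K) → ℂ)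
    (w : State (parallelRegisters P K) N → ℕ) :
    (forward P K).cost (tensorRep _ N) (exchangeEnd _ N) w (idleState P K N β) =
      ∑ r ∈ Finset.range P.rounds, w (parallelState P K N β (copyState P N r)) := by
  rw [forward, Schedule.cost_seq, Schedule.final_gate, Schedule.cost_gate, tensorRep_loadGate,
    zero_add]
  exact Finset.sum_congr rfl fun r _ => by rw [run_parallel]

/-- Given a basis state of the main registers, every copy runs on a classical input. A nonzero
amplitude of the product has nonzero factors, so a used cell belongs to one copy and is used by `P`
on that classical input. -/
theorem card_usedCells_parallelState (N : Network n) (β : (Fin n → MainBasis K) → ℂ) (r : ℕ)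
    (U : Finset (Σ v : Fin n, Fin (N.deg v) × Fin P.width))
    (hU : ∀ x, sent P N (Pi.single x 1) r ⊆ U) :
    (usedCells (parallelRegisters P K) N (parallelState P K N β (copyState P N r))).card ≤
      Fintype.card (K × Bool) * U.card := by
  classical
  have hsub : usedCells (parallelRegisters P K) N (parallelState P K N β (copyState P N r)) ⊆
      ((Finset.univ : Finset (K × Bool)) ×ˢ U).image fun p =>
        ⟨p.2.1, p.2.2.1, cellEquiv P K (p.1, p.2.2.2)⟩ := by
    rintro ⟨v, i, m⟩ hq
    obtain ⟨⟨j, l⟩, rfl⟩ := (cellEquiv P K).surjective m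
    rw [mem_usedCells] at hq
    obtain ⟨c, hc, hq⟩ := hq
    refine Finset.mem_image.2 ⟨(j, ⟨v, i, l⟩), Finset.mem_product.2 ⟨Finset.mem_univ _, ?_⟩, rfl⟩
    apply hU fun v => copyInput j ((configEquiv P K N c).1 v)
    rw [sent_eq_usedCells, mem_usedCells]
    have h := right_ne_zero_of_mul hc
    rw [Finset.prod_ne_zero_iff] at h
    exact ⟨(configEquiv P K N c).2 j, h j (Finset.mem_univ j), hq⟩
  refine (Finset.card_le_card hsub).trans (Finset.card_image_le.trans ?_)
  rw [Finset.card_product, Finset.card_univ]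

theorem tensorRep_mainGate_const (N : Network n) (D : unitaryGroup (MainBasis K) ℂ)
    (β : (Fin n → MainBasis K) → ℂ) :
    tensorRep (parallelRegisters P K) N (mainGate P K fun _ => D) (idleState P K N β) =
      idleState P K N ((piKronecker fun _ => (D : Matrix (MainBasis K) (MainBasis K) ℂ)) *ᵥ β) := by
  rw [tensorRep_apply]
  exact piKronecker_mulVec_splitState_ext (fun v => localEquiv P K (N.deg v)) (fun _ _ => D)
    (fun _ _ => D) β _ (fun _ _ _ _ => rfl) fun _ _ _ _ => rfl

/-- The copies may end in any entangled state, but their outputs are certain and the same at all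
parties, so the control can be read as a function of the main registers. A gate that preserves the
inputs of the copies connects only branches with the same final state of the copies. That state
factors out, and the result is again a final state of `forward`. -/
theorem tensorRep_mainGate_forward (N : Network n) (hP : Computes P N (H 0))
    (D : (K × Bool → Bool) → unitaryGroup (MainBasis K) ℂ)
    (hD : ∀ f e e', (D f : Matrix (MainBasis K) (MainBasis K) ℂ) e e' ≠ 0 →
      ∀ j, copyInput j e' = copyInput j e) (β : (Fin n → MainBasis K) → ℂ) :
    tensorRep (parallelRegisters P K) N (mainGate P K D)
        ((forward P K).final (tensorRep _ N) (exchangeEnd _ N) (idleState P K N β)) =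
      (forward P K).final (tensorRep _ N) (exchangeEnd _ N) (idleState P K N fun z =>
        ((piKronecker fun _ => (D (copyResult z) : Matrix (MainBasis K) (MainBasis K) ℂ)) *ᵥ β)
          z) := by
  rw [final_forward, final_forward, tensorRep_apply]
  refine piKronecker_mulVec_splitState_ext (fun v => localEquiv P K (N.deg v))
    (fun _ y => D fun j => (y j).output)
    (fun z _ => D (copyResult z)) β _ (fun z y h v => ?_) fun z z' y h => ?_
  · congr 2
    funext j
    exact hP _ _ (Finset.prod_ne_zero_iff.1 h j (Finset.mem_univ j)) v
  · refine Finset.prod_congr rfl fun j _ => ?_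
    have : (fun v => copyInput j (z' v)) = fun v => copyInput j (z v) :=
      funext fun v => hD _ _ _ (h v) j
    simp only [copyState, this]

end Parallel

theorem H_zero_iff (x : Fin n → Bool) : H 0 x = true ↔ ∀ v, x v = false := by
  simp [H, Finset.filter_eq_empty_iff]

/-! ### Coins, the phase test and the outcome -/

section Coins

variable {K : Type} [Fintype K] [DecidableEq K]

/-- The gate that applies a unitary matrix to every coin. -/
def coinGate (M : K → unitaryGroup Bool ℂ) : unitaryGroup (MainBasis K) ℂ :=
  blockUnitary ((Equiv.prodComm (K → Bool) (Bool × Bool)).trans (Equiv.prodComm _ _))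
    fun _ => piUnitary M

/-- The state with amplitudes `a` on the input and output qubits such that, given `s` there, the
`k`-th coins of all parties are in the state `g k s`. -/
def coinState (a : (Fin n → Bool × Bool) → ℂ)
    (g : K → (Fin n → Bool × Bool) → (Fin n → Bool) → ℂ) : (Fin n → MainBasis K) → ℂ :=
  splitState (fun _ => Equiv.prodComm (K → Bool) (Bool × Bool)) a fun s y => ∏ k, g k s (y k)

theorem coinState_apply (a : (Fin n → Bool × Bool) → ℂ)
    (g : K → (Fin n → Bool × Bool) → (Fin n → Bool) → ℂ) (z : Fin n → MainBasis K) :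
    coinState a g z = a (fun v => (z v).2) * ∏ k, g k (fun v => (z v).2) fun v => (z v).1 k := rfl

theorem coinGate_mulVec_coinState (M : K → unitaryGroup Bool ℂ) (a : (Fin n → Bool × Bool) → ℂ)
    (g : K → (Fin n → Bool × Bool) → (Fin n → Bool) → ℂ) :
    (piKronecker fun _ => (coinGate M : Matrix (MainBasis K) (MainBasis K) ℂ)) *ᵥ coinState a g =
      coinState a fun k s => (piKronecker fun _ => (M k : Matrix Bool Bool ℂ)) *ᵥ g k s :=
  piKronecker_mulVec_splitState_copies (fun _ => Equiv.prodComm (K → Bool) (Bool × Bool))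
    (fun _ _ k => M k) a g

/-- The phase gate: a factor `θ k` for every `k` such that no party with input `true` has coin
`true`. -/
noncomputable def phaseGate (θ : K → Circle) (f : K × Bool → Bool) :
    unitaryGroup (MainBasis K) ℂ :=
  scalarUnitary _ (∏ k, if f (k, true) then θ k else 1)

theorem copyInput_eq_of_phaseGate (θ : K → Circle) (f : K × Bool → Bool) (e e' : MainBasis K)
    (h : (phaseGate θ f : Matrix (MainBasis K) (MainBasis K) ℂ) e e' ≠ 0) (j : K × Bool) :
    copyInput j e' = copyInput j e := by
  by_cases he : e = e'
  · rw [he]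
  · rw [phaseGate, coe_scalarUnitary, Matrix.smul_apply, one_apply_ne he, smul_zero] at h
    exact absurd rfl h

/-- All `n` parties apply the phase, whether active or not, so it enters as `θ k ^ n`. -/
theorem phaseGate_mulVec_coinState (θ : K → Circle) (a : (Fin n → Bool × Bool) → ℂ)
    (g : K → (Fin n → Bool × Bool) → (Fin n → Bool) → ℂ) :
    (fun z => ((piKronecker fun _ => (phaseGate θ (copyResult z) :
      Matrix (MainBasis K) (MainBasis K) ℂ)) *ᵥ coinState a g) z) =
      coinState a fun k s b =>
        (if H 0 (fun v => (s v).1 && b v) = true then (θ k : ℂ) ^ n else 1) * g k s b := by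
  funext z
  simp only [phaseGate, coe_scalarUnitary]
  rw [piKronecker_smul_one_mulVec, Pi.smul_apply, coinState_apply, coinState_apply, smul_eq_mul,
    Finset.prod_mul_distrib, Fintype.card_fin, ← Circle.coe_pow, ← Finset.prod_pow]
  rw [mul_left_comm]
  congr 2
  refine (map_prod Circle.coeHom _ _).trans (Finset.prod_congr rfl fun k _ => ?_)
  have h : copyResult z (k, true) = H 0 fun v => (z v).2.1 && (z v).1 k := by
    simp [copyResult, copyInput]
  rw [h]
  split_ifs
  · rw [map_pow]; rfl
  · simp

/-- The permutation of the main basis states that negates the output. -/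
def flipOutput (K : Type) : Equiv.Perm (MainBasis K) where
  toFun e := (e.1, e.2.1, !e.2.2)
  invFun e := (e.1, e.2.1, !e.2.2)
  left_inv e := by simp
  right_inv e := by simp

/-- The gate that negates the output unless, for every `k`, exactly one of the copies `(k, false)`
and `(k, true)` has result `true`. -/
def outputGate (f : K × Bool → Bool) : unitaryGroup (MainBasis K) ℂ :=
  permUnitary (if ∀ k, f (k, false) ≠ f (k, true) then 1 else flipOutput K)

theorem copyInput_eq_of_outputGate (f : K × Bool → Bool) (e e' : MainBasis K)
    (h : (outputGate f : Matrix (MainBasis K) (MainBasis K) ℂ) e e' ≠ 0) (j : K × Bool) :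
    copyInput j e' = copyInput j e := by
  rw [outputGate, permUnitary_apply] at h
  have h' := (ite_ne_right_iff.1 h).1
  rw [← h']
  split_ifs <;> rfl

/-- The state of the `k`-th coins of all parties when the outcome is computed. -/
noncomputable def testedCoins (U V : unitaryGroup Bool ℂ) (ω : ℂ) (x : Fin n → Bool) :
    (Fin n → Bool) → ℂ :=
  (piKronecker fun _ => (V : Matrix Bool Bool ℂ)) *ᵥ fun b =>
    (if H 0 (fun v => x v && b v) = true then ω else 1) *
      ((piKronecker fun _ => (U : Matrix Bool Bool ℂ)) *ᵥ Pi.single (fun _ => false) 1) b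

/-- `U` and `V` make the coins of `k` parties inconsistent. -/
def Separates (k : ℕ) (U V : unitaryGroup Bool ℂ) (ω : ℂ) : Prop :=
  ∀ b : Bool, (((V : Matrix Bool Bool ℂ) *ᵥ fun b' => (U : Matrix Bool Bool ℂ) b' false) b) ^ k +
    (ω - 1) * ((V : Matrix Bool Bool ℂ) b false * (U : Matrix Bool Bool ℂ) false false) ^ k = 0

/-- The phase test adds `ω - 1` times the projection onto "all active coins are `false`", so before
`V` the state is a sum of two product states. The inactive parties contribute the same factor to
both, and the active ones contribute the two terms of `Separates`. -/
theorem testedCoins_eq_zero {U V : unitaryGroup Bool ℂ} {ω : ℂ} {x b : Fin n → Bool} {b₀ : Bool}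
    (h : Separates (Finset.univ.filter fun v => x v = true).card U V ω)
    (hb : ∀ v, x v = true → b v = b₀) : testedCoins U V ω x b = 0 := by
  set u : Bool → ℂ := fun b' => (U : Matrix Bool Bool ℂ) b' false with hu
  have h1 : (fun b : Fin n → Bool => (if H 0 (fun v => x v && b v) = true then ω else 1) *
      ((piKronecker fun _ => (U : Matrix Bool Bool ℂ)) *ᵥ Pi.single (fun _ => false) 1) b) =
      (fun b => ∏ v, u (b v)) + (ω - 1) • fun b => ∏ v,
        (if x v = true then Pi.single false (u false) else u) (b v) := by
    funext b
    rw [mulVec_single_one, col_apply, piKronecker_apply]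
    simp only [Pi.add_apply, Pi.smul_apply, smul_eq_mul]
    by_cases hH : H 0 (fun v => x v && b v) = true
    · rw [if_pos hH]
      rw [H_zero_iff] at hH
      have : ∏ v, (if x v = true then Pi.single false (u false) else u) (b v) =
          ∏ v, u (b v) := by
        refine Finset.prod_congr rfl fun v _ => ?_
        have := hH v
        split_ifs with hx
        · have hbv : b v = false := by simpa [hx] using this
          rw [hbv, Pi.single_eq_same]
        · rfl
      rw [this]
      ring
    · rw [if_neg hH]
      rw [H_zero_iff] at hH
      push Not at hH
      obtain ⟨v, hv⟩ := hH
      have hv' : x v = true ∧ b v = true := by simpa using hv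
      rw [Finset.prod_eq_zero (f := fun v =>
        (if x v = true then Pi.single false (u false) else u) (b v)) (Finset.mem_univ v)
        (by simp [hv'.1, hv'.2])]
      ring
  have h2 : ∀ v, ((V : Matrix Bool Bool ℂ) *ᵥ
      (if x v = true then Pi.single false (u false) else u)) (b v) =
      if x v = true then (V : Matrix Bool Bool ℂ) b₀ false * u false
        else ((V : Matrix Bool Bool ℂ) *ᵥ u) (b v) := by
    intro v
    split_ifs with hx
    · rw [mulVec_single, hb v hx]
      simp
    · rfl
  have h3 : ∀ v, ((V : Matrix Bool Bool ℂ) *ᵥ u) (b v) =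
      if x v = true then ((V : Matrix Bool Bool ℂ) *ᵥ u) b₀
        else ((V : Matrix Bool Bool ℂ) *ᵥ u) (b v) := by
    intro v
    split_ifs with hx
    · rw [hb v hx]
    · rfl
  rw [testedCoins, h1, mulVec_add, mulVec_smul, Pi.add_apply, Pi.smul_apply,
    piKronecker_mulVec_prod (X := fun _ : Fin n => Bool) _ (fun _ => u),
    piKronecker_mulVec_prod (X := fun _ : Fin n => Bool), smul_eq_mul,
    Finset.prod_congr rfl fun v _ => h2 v, Finset.prod_congr rfl fun v _ => h3 v,
    Finset.prod_ite, Finset.prod_ite, Finset.prod_const, Finset.prod_const]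
  have := h b₀
  linear_combination (∏ v with ¬ x v = true, ((V : Matrix Bool Bool ℂ) *ᵥ u) (b v)) * this

theorem copyResult_eq_true_iff (z : Fin n → MainBasis K) (k : K) (b : Bool) :
    copyResult z (k, b) = true ↔ ∀ v, (z v).2.1 = true → (z v).1 k = !b := by
  rw [copyResult, H_zero_iff]
  refine forall_congr' fun v => ?_
  rw [copyInput]
  cases (z v).2.1 <;> cases (z v).1 k <;> cases b <;> simp

end Coins

/-- The outcome decides whether exactly one party has input `true`, unless the coins with the
number of these parties are consistent. -/
theorem forall_copyResult_ne_iff [NeZero n] (z : Fin n → MainBasis (Fin n))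
    (hz : ∀ k : Fin n, 2 ≤ (k : ℕ) + 1 →
      (Finset.univ.filter fun v => (z v).2.1 = true).card = k + 1 →
      ∀ b, ¬ ∀ v, (z v).2.1 = true → (z v).1 k = b) :
    (∀ k, copyResult z (k, false) ≠ copyResult z (k, true)) ↔ H 1 (fun v => (z v).2.1) = true := by
  rw [H, decide_eq_true_iff]
  constructor
  · intro h
    by_contra hS
    set S := Finset.univ.filter fun v => (z v).2.1 = true with hSdef
    -- With no active party both results are `true` for every guess, for example `0`. With at least
    -- two, the correct guess has both results `false`; it is the index `S.card - 1`, since index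
    -- `k` stands for weight `k + 1`.
    obtain h0 | h2 : S.card = 0 ∨ 2 ≤ S.card := by omega
    · apply h 0
      rw [Finset.card_eq_zero] at h0
      have hno : ∀ v, ¬ (z v).2.1 = true := fun v hv => by
        have : v ∈ S := by simp [hSdef, hv]
        simp [h0] at this
      rw [(copyResult_eq_true_iff z 0 false).2 fun v hv => absurd hv (hno v),
        (copyResult_eq_true_iff z 0 true).2 fun v hv => absurd hv (hno v)]
    · have hn : S.card ≤ n := by simpa using Finset.card_le_univ S
      have hk := hz ⟨S.card - 1, by omega⟩ (by simp; omega) (by simp; omega)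
      apply h ⟨S.card - 1, by omega⟩
      have hf : ∀ b, copyResult z (⟨S.card - 1, by omega⟩, b) = false := by
        intro b
        rw [← Bool.not_eq_true, copyResult_eq_true_iff]
        exact hk _
      rw [hf, hf]
  · intro hS k h
    obtain ⟨v, hv⟩ := Finset.card_eq_one.1 hS
    have hmem : ∀ w, (z w).2.1 = true ↔ w = v := fun w => by
      have := Finset.ext_iff.1 hv w
      simpa using this
    have h' := Bool.eq_iff_iff.1 h
    rw [copyResult_eq_true_iff, copyResult_eq_true_iff] at h'
    simp only [hmem, forall_eq] at h'
    cases hc : (z v).1 k <;> simp [hc] at h'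

/-- The outcome is read from the coins, but on the support of their state it depends only on the
inputs. The coin state does not involve the outputs, so it survives the flip unchanged. -/
theorem outputGate_mulVec_coinState [NeZero n] (U V : Fin n → unitaryGroup Bool ℂ) (ω : Fin n → ℂ)
    (h : ∀ k : Fin n, 2 ≤ (k : ℕ) + 1 → Separates (k + 1) (U k) (V k) (ω k))
    (a : (Fin n → Bool × Bool) → ℂ) :
    (fun z => ((piKronecker fun _ => (outputGate (copyResult z) :
      Matrix (MainBasis (Fin n)) (MainBasis (Fin n)) ℂ)) *ᵥ
        coinState a fun k s => testedCoins (U k) (V k) (ω k) fun v => (s v).1) z) =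
      coinState (fun s => a fun v =>
          ((s v).1, if H 1 (fun v => (s v).1) = true then (s v).2 else !(s v).2))
        fun k s => testedCoins (U k) (V k) (ω k) fun v => (s v).1 := by
  funext z
  rw [outputGate, piKronecker_permUnitary_mulVec]
  by_cases h0 : ∏ k, testedCoins (U k) (V k) (ω k) (fun v => (z v).2.1) (fun v => (z v).1 k) = 0
  · rw [coinState_apply, coinState_apply]
    dsimp only
    rw [h0, mul_zero]
    refine mul_eq_zero_of_right _ ?_
    rw [← h0]
    split_ifs <;> rfl
  · have key := forall_copyResult_ne_iff z fun k hk hcard b hb =>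
      Finset.prod_ne_zero_iff.1 h0 k (Finset.mem_univ k)
        (testedCoins_eq_zero (by rw [hcard]; exact h k hk) hb)
    simp only [key]
    rw [coinState_apply, coinState_apply]
    split_ifs <;> rfl

/-! ### Choice of the coin gates and phases -/

theorem exists_re_pow_eq_half {k : ℕ} (hk : 2 ≤ k) :
    ∃ ζ : ℂ, ζ ^ k = 1 ∧ ‖ζ‖ = 1 ∧ ∃ t ∈ Set.Icc (0 : ℝ) 1, ((1 + (ζ - 1) * t) ^ k).re = 1 / 2 := by
  have hk0 : (k : ℂ) ≠ 0 := Nat.cast_ne_zero.2 (by omega)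
  set η : ℂ := Complex.exp ((Real.pi / k : ℝ) * Complex.I) with hη
  have hηk : η ^ k = -1 := by
    rw [hη, ← Complex.exp_nat_mul, ← Complex.exp_pi_mul_I]
    congr 1
    push_cast
    field_simp
  have hηn : ‖η‖ = 1 := Complex.norm_exp_ofReal_mul_I _
  have hη0 : η ≠ 0 := Complex.exp_ne_zero _
  have hcos : η ^ 2 + 1 = 2 * Real.cos (Real.pi / k) * η := by
    have h1 : (2 : ℂ) * Real.cos (Real.pi / k) = η + η⁻¹ := by
      rw [Complex.ofReal_cos, Complex.two_cos, hη, ← Complex.exp_neg, neg_mul]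
    rw [h1]
    field_simp
  refine ⟨η ^ 2, by rw [← pow_mul, mul_comm, pow_mul, hηk]; norm_num, by simp [hηn], ?_⟩
  set g : ℝ → ℝ := fun t => ((1 + (η ^ 2 - 1) * t) ^ k).re with hg
  -- The base moves from `1` along the chord towards `η ^ 2`. At the midpoint it is `cos (π / k) *
  -- η`, whose `k`-th power is `-cos (π / k) ^ k ≤ 0`, so the value `1 / 2` is passed.
  have hcont : ContinuousOn g (Set.Icc 0 (1 / 2)) := by
    apply Continuous.continuousOn
    fun_prop
  have h0 : g 0 = 1 := by simp [hg]
  have h1 : g (1 / 2) ≤ 0 := by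
    have e : (1 + (η ^ 2 - 1) * ((1 / 2 : ℝ) : ℂ)) = (Real.cos (Real.pi / k) : ℂ) * η := by
      push_cast at hcos ⊢
      linear_combination hcos / 2
    have hc : 0 ≤ Real.cos (Real.pi / k) := by
      apply Real.cos_nonneg_of_neg_pi_div_two_le_of_le
      · have : 0 ≤ Real.pi / k := by positivity
        linarith [Real.pi_pos]
      · exact div_le_div_of_nonneg_left Real.pi_pos.le two_pos (by exact_mod_cast hk)
    simp only [hg]
    rw [e, mul_pow, hηk, ← Complex.ofReal_pow, mul_neg_one, Complex.neg_re, Complex.ofReal_re]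
    exact neg_nonpos.2 (pow_nonneg hc k)
  obtain ⟨t, ht, hgt⟩ := intermediate_value_Icc' (by norm_num) hcont
    (show (1 / 2 : ℝ) ∈ Set.Icc (g (1 / 2)) (g 0) by
      rw [h0]; constructor <;> linarith)
  exact ⟨t, ⟨ht.1, ht.2.trans (by norm_num)⟩, hgt⟩

/-- The matrix with entries `a`, `b`, `c`, `d`, indexed by `Bool`. -/
def boolMatrix (a b c d : ℂ) : Matrix Bool Bool ℂ :=
  Matrix.of fun i j => cond i (cond j d c) (cond j b a)

/-- Let `V` be the real reflection with first column `(p, q)`, and let the first column `(w, v)` of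
`U` be `V` applied to `(ζ p, q)`. Then `V` returns `(ζ p, q)`, and since `ζ ^ k = 1` both equations
reduce to `1 + (ω - 1) w ^ k = 0`. Its solution `ω = 1 - (w ^ k)⁻¹` has modulus one when the real
part of `w ^ k` is `1 / 2`, that is, when `w ^ k` is equidistant from `0` and `1`. -/
theorem exists_separates {k : ℕ} (hk : 2 ≤ k) :
    ∃ (U V : unitaryGroup Bool ℂ) (ω : Circle), Separates k U V ω := by
  obtain ⟨ζ, hζk, hζ, t, ⟨ht0, ht1⟩, hre⟩ := exists_re_pow_eq_half hk
  set w : ℂ := 1 + (ζ - 1) * t with hw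
  set p : ℝ := √t with hp
  set q : ℝ := √(1 - t) with hq
  have hpp : p ^ 2 = t := Real.sq_sqrt ht0
  have hqq : q ^ 2 = 1 - t := Real.sq_sqrt (by linarith)
  have hppC : (p : ℂ) ^ 2 = t := by exact_mod_cast hpp
  have hqqC : (q : ℂ) ^ 2 = 1 - t := by exact_mod_cast hqq
  have hζζ : ζ * (starRingEnd ℂ) ζ = 1 := by
    rw [Complex.mul_conj, Complex.normSq_eq_norm_sq, hζ]; simp
  have hwk : w ^ k ≠ 0 := fun h => by rw [h] at hre; norm_num at hre
  set v : ℂ := (ζ - 1) * (p * q) with hv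
  have hV : boolMatrix p q q (-p) ∈ unitaryGroup Bool ℂ := by
    rw [mem_unitaryGroup_iff]
    ext i j
    cases i <;> cases j <;> simp [boolMatrix, mul_apply, one_apply, star_apply] <;>
      first
        | linear_combination hppC + hqqC
        | ring
  have hwv : w * (starRingEnd ℂ) w + v * (starRingEnd ℂ) v = 1 := by
    simp only [hw, hv, map_add, map_mul, map_sub, map_one, Complex.conj_ofReal]
    linear_combination (t : ℂ) * hζζ +
      (ζ - 1) * ((starRingEnd ℂ) ζ - 1) * (q : ℂ) ^ 2 * hppC +
      (ζ - 1) * ((starRingEnd ℂ) ζ - 1) * t * hqqC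
  have hU : boolMatrix w (-(starRingEnd ℂ) v) v ((starRingEnd ℂ) w) ∈ unitaryGroup Bool ℂ := by
    rw [mem_unitaryGroup_iff]
    ext i j
    cases i <;> cases j <;> simp [boolMatrix, mul_apply, one_apply, star_apply] <;>
      first
        | linear_combination hwv
        | ring
  have hω : ‖1 - (w ^ k)⁻¹‖ = 1 := by
    have h1 : ‖w ^ k - 1‖ = ‖w ^ k‖ := by
      rw [← sq_eq_sq₀ (norm_nonneg _) (norm_nonneg _), ← Complex.normSq_eq_norm_sq,
        ← Complex.normSq_eq_norm_sq, Complex.normSq_apply, Complex.normSq_apply, Complex.sub_re,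
        Complex.sub_im, Complex.one_re, Complex.one_im, hre]
      ring
    rw [show 1 - (w ^ k)⁻¹ = (w ^ k - 1) / w ^ k by field_simp, norm_div, h1,
      div_self (norm_ne_zero_iff.2 hwk)]
  refine ⟨⟨_, hU⟩, ⟨_, hV⟩, ⟨1 - (w ^ k)⁻¹, mem_sphere_zero_iff_norm.2 hω⟩, fun b => ?_⟩
  -- `h0` and `h1` are the two coordinates of `V` applied to `(w, v)`.
  have h0 : (p : ℂ) * w + q * v = ζ * p := by
    simp only [hw, hv]
    linear_combination (ζ - 1) * p * (hppC + hqqC) - (ζ - 1) * p * hppC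
  have h1 : (q : ℂ) * w - p * v = q := by
    simp only [hw, hv]
    linear_combination -(ζ - 1) * q * hppC
  cases b
  · simp only [boolMatrix, mulVec, dotProduct, Fintype.sum_bool, of_apply, cond_true, cond_false]
    rw [add_comm ((q : ℂ) * v), h0, mul_pow, mul_pow, hζk]
    field_simp
    ring
  · simp only [boolMatrix, mulVec, dotProduct, Fintype.sum_bool, of_apply, cond_true, cond_false]
    rw [neg_mul, neg_add_eq_sub, h1, mul_pow]
    field_simp
    ring

theorem exists_circle_pow_eq (ω : Circle) {n : ℕ} (hn : n ≠ 0) : ∃ θ : Circle, θ ^ n = ω := by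
  refine ⟨Circle.exp (Complex.arg ω / n), ?_⟩
  rw [← Circle.exp_natCast_mul, mul_div_cancel₀ _ (by exact_mod_cast hn), Circle.exp_arg]

theorem bitsOn_withSchedule (P : Protocol) (S : Schedule (LocalGates P)) (N : Network n)
    (α : (Fin n → Bool) → ℂ) :
    bitsOn (P.withSchedule S) N α =
      S.cost (tensorRep P N) (exchangeEnd P N) (bitCost P N) (initialState P N α) :=
  bitsOn_eq_cost (P.withSchedule S) N α

theorem activeRoundsOn_withSchedule (P : Protocol) (S : Schedule (LocalGates P)) (N : Network n)
    (α : (Fin n → Bool) → ℂ) :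
    activeRoundsOn (P.withSchedule S) N α =
      S.cost (tensorRep P N) (exchangeEnd P N) (roundCost P N) (initialState P N α) :=
  activeRoundsOn_eq_cost (P.withSchedule S) N α

/-! ### Clean states of the new protocol in terms of coins and copies -/

section CleanStates

variable (P : Protocol) {K : Type} [Fintype K] [DecidableEq K]

/-- The amplitudes `a` on the input and output qubits, with all coins `false`. -/
noncomputable def cleanCoins (a : (Fin n → Bool × Bool) → ℂ) : (Fin n → MainBasis K) → ℂ :=
  coinState a fun _ _ => Pi.single (fun _ => false) 1

theorem eq_cleanConfig_iff (N : Network n) (c : Config (parallelRegisters P K) N)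
    (x : Fin n → Bool) (y : Bool) :
    c = cleanConfig (parallelRegisters P K) N x y ↔
      (((fun v => ((configEquiv P K N c).1 v).2.1) = x ∧
        ∀ v, ((configEquiv P K N c).1 v).2.2 = y) ∧
        ∀ k, (fun v => ((configEquiv P K N c).1 v).1 k) = fun _ => false) ∧
        ∀ j, (configEquiv P K N c).2 j = cleanConfig P N (fun _ => false) true := by
  have h : configEquiv P K N (cleanConfig (parallelRegisters P K) N x y) =
      (fun v => (fun _ => false, x v, y), fun _ => cleanConfig P N (fun _ => false) true) := rfl
  rw [← (configEquiv P K N).injective.eq_iff, h]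
  obtain ⟨z, y'⟩ := configEquiv P K N c
  simp only [funext_iff, Prod.ext_iff]
  constructor
  · rintro ⟨h1, h2⟩
    exact ⟨⟨⟨fun v => (h1 v).2.1, fun v => (h1 v).2.2⟩, fun k v => (h1 v).1 k⟩, h2⟩
  · rintro ⟨⟨⟨h1, h2⟩, h3⟩, h4⟩
    exact ⟨fun v => ⟨fun k => h3 k v, h1 v, h2 v⟩, h4⟩

theorem cleanState_eq_idleState (N : Network n) (α : (Fin n → Bool) → ℂ)
    (f : (Fin n → Bool) → Bool) :
    cleanState (parallelRegisters P K) N α f = idleState P K N (cleanCoins fun s =>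
      if ∀ v, (s v).2 = f (fun v => (s v).1) then α (fun v => (s v).1) else 0) := by
  funext c
  have h1 : cleanState (parallelRegisters P K) N α f c =
      ∑ x, α x * if c = cleanConfig (parallelRegisters P K) N x (f x) then 1 else 0 := by
    simp only [cleanState, Finset.sum_apply, Pi.smul_apply, Pi.single_apply, smul_eq_mul]
  have h2 : idleState P K N (cleanCoins fun s =>
      if ∀ v, (s v).2 = f (fun v => (s v).1) then α (fun v => (s v).1) else 0) c =
      ((if ∀ v, ((configEquiv P K N c).1 v).2.2 =
        f (fun v => ((configEquiv P K N c).1 v).2.1) then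
          α (fun v => ((configEquiv P K N c).1 v).2.1) else 0) *
      ∏ k : K, if (fun v => ((configEquiv P K N c).1 v).1 k) = fun _ => false then 1 else 0) *
      ∏ j, if (configEquiv P K N c).2 j = cleanConfig P N (fun _ => false) true then 1 else 0 := by
    simp only [← Pi.single_apply]
    rfl
  rw [h1, h2]
  simp only [eq_cleanConfig_iff, Finset.prod_ite_zero, Finset.prod_const_one, Finset.mem_univ,
    true_implies]
  rw [Finset.sum_eq_single fun v => ((configEquiv P K N c).1 v).2.1]
  · simp only [true_and, ite_and]
    split_ifs <;> simp
  · intro x _ hx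
    rw [if_neg fun h => hx h.1.1.1.symm, mul_zero]
  · simp

end CleanStates

/-! ### The algorithm for weight one: correctness and cost -/

section Algorithm

variable (P : Protocol) (U V : Fin n → unitaryGroup Bool ℂ) (θ : Fin n → Circle)

/-- Preparation of the coins. -/
noncomputable def coinSchedule : Schedule (LocalGates (parallelRegisters P (Fin n))) :=
  (Schedule.gate (mainGate P (Fin n) fun _ => coinGate U)).seq
    (((forward P (Fin n)).call (mainGate P (Fin n) (phaseGate θ))).seq
      (Schedule.gate (mainGate P (Fin n) fun _ => coinGate V)))

/-- Computation of the weight-one function: prepare the coins, compute the outcome, and undo the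
preparation of the coins. -/
noncomputable def weightOneSchedule : Schedule (LocalGates (parallelRegisters P (Fin n))) :=
  (coinSchedule P U V θ).seq
    (((forward P (Fin n)).call (mainGate P (Fin n) outputGate)).seq (coinSchedule P U V θ).rev)

theorem rounds_weightOneSchedule : (weightOneSchedule P U V θ).rounds = 6 * P.rounds := by
  simp only [weightOneSchedule, coinSchedule, forward, Schedule.call, Schedule.seq, Schedule.rev,
    Schedule.gate]
  ring

variable {P} {N : Network n}

theorem tensorRep_phaseGate_forward (hP : Computes P N (H 0)) (a : (Fin n → Bool × Bool) → ℂ) :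
    tensorRep (parallelRegisters P (Fin n)) N (mainGate P (Fin n) (phaseGate θ))
      ((forward P (Fin n)).final (tensorRep _ N) (exchangeEnd _ N)
        ((Schedule.gate (mainGate P (Fin n) fun _ => coinGate U)).final (tensorRep _ N)
          (exchangeEnd _ N) (idleState P (Fin n) N (cleanCoins a)))) =
      (forward P (Fin n)).final (tensorRep _ N) (exchangeEnd _ N)
        (idleState P (Fin n) N (coinState a fun k s b =>
          (if H 0 (fun v => (s v).1 && b v) = true then (θ k : ℂ) ^ n else 1) *
            ((piKronecker fun _ => (U k : Matrix Bool Bool ℂ)) *ᵥ Pi.single (fun _ => false) 1)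
              b)) := by
  rw [Schedule.final_gate, tensorRep_mainGate_const, cleanCoins, coinGate_mulVec_coinState,
    tensorRep_mainGate_forward P (Fin n) N hP _ (copyInput_eq_of_phaseGate θ),
    phaseGate_mulVec_coinState]

theorem final_coinSchedule (hP : Computes P N (H 0)) (a : (Fin n → Bool × Bool) → ℂ) :
    (coinSchedule P U V θ).final (tensorRep _ N) (exchangeEnd _ N)
        (idleState P (Fin n) N (cleanCoins a)) =
      idleState P (Fin n) N (coinState a fun k s =>
        testedCoins (U k) (V k) ((θ k : ℂ) ^ n) fun v => (s v).1) := by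
  rw [coinSchedule, Schedule.final_seq, Schedule.final_seq,
    Schedule.final_call _ (exchangeEnd_exchangeEnd _ N) _ _
      (tensorRep_phaseGate_forward U θ hP a),
    Schedule.final_gate, tensorRep_mainGate_const, coinGate_mulVec_coinState]
  rfl

theorem cost_coinSchedule_le (hP : Computes P N (H 0))
    (w : State (parallelRegisters P (Fin n)) N → ℕ)
    (hw : ∀ ψ, w (exchangeEnd _ N ψ) = w ψ) (B : ℕ)
    (hB : ∀ β, (forward P (Fin n)).cost (tensorRep _ N) (exchangeEnd _ N) w
      (idleState P (Fin n) N β) ≤ B) (a : (Fin n → Bool × Bool) → ℂ) :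
    (coinSchedule P U V θ).cost (tensorRep _ N) (exchangeEnd _ N) w
      (idleState P (Fin n) N (cleanCoins a)) ≤ 2 * B := by
  rw [coinSchedule, Schedule.cost_seq, Schedule.cost_seq, Schedule.cost_gate, Schedule.cost_gate,
    Schedule.cost_call _ (exchangeEnd_exchangeEnd _ N) w hw _ _
      (tensorRep_phaseGate_forward U θ hP a),
    Schedule.final_gate, tensorRep_mainGate_const, zero_add, add_zero, two_mul]
  exact add_le_add (hB _) (hB _)

variable {U V θ}

/-- The effect of the function of weight one on the input and output qubits. -/
def applyWeightOne (a : (Fin n → Bool × Bool) → ℂ) (s : Fin n → Bool × Bool) : ℂ :=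
  a fun v => ((s v).1, if H 1 (fun v => (s v).1) = true then (s v).2 else !(s v).2)

/-- The state after the output gate is again one that the coin preparation produces, from the
flipped amplitudes. This is what allows the preparation to be undone afterwards. -/
theorem tensorRep_outputGate_forward [NeZero n] (hP : Computes P N (H 0))
    (h : ∀ k : Fin n, 2 ≤ (k : ℕ) + 1 → Separates (k + 1) (U k) (V k) ((θ k : ℂ) ^ n))
    (a : (Fin n → Bool × Bool) → ℂ) :
    tensorRep (parallelRegisters P (Fin n)) N (mainGate P (Fin n) outputGate)
      ((forward P (Fin n)).final (tensorRep _ N) (exchangeEnd _ N)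
        ((coinSchedule P U V θ).final (tensorRep _ N) (exchangeEnd _ N)
          (idleState P (Fin n) N (cleanCoins a)))) =
      (forward P (Fin n)).final (tensorRep _ N) (exchangeEnd _ N)
        ((coinSchedule P U V θ).final (tensorRep _ N) (exchangeEnd _ N)
          (idleState P (Fin n) N (cleanCoins (applyWeightOne a)))) := by
  rw [final_coinSchedule U V θ hP, final_coinSchedule U V θ hP,
    tensorRep_mainGate_forward P (Fin n) N hP _ copyInput_eq_of_outputGate,
    outputGate_mulVec_coinState U V _ h]
  rfl

theorem final_weightOneSchedule [NeZero n] (hP : Computes P N (H 0))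
    (h : ∀ k : Fin n, 2 ≤ (k : ℕ) + 1 → Separates (k + 1) (U k) (V k) ((θ k : ℂ) ^ n))
    (a : (Fin n → Bool × Bool) → ℂ) :
    (weightOneSchedule P U V θ).final (tensorRep _ N) (exchangeEnd _ N)
        (idleState P (Fin n) N (cleanCoins a)) =
      idleState P (Fin n) N (cleanCoins (applyWeightOne a)) := by
  rw [weightOneSchedule, Schedule.final_seq, Schedule.final_seq,
    Schedule.final_call _ (exchangeEnd_exchangeEnd _ N) _ _ (tensorRep_outputGate_forward hP h a),
    Schedule.final_rev _ (exchangeEnd_exchangeEnd _ N)]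

/-- The preparation of the coins, the computation of the outcome and the undoing of the preparation
each contain one conjugation by `forward`, hence two runs. A run backwards is charged as a run
forwards from the state it ends in. -/
theorem cost_weightOneSchedule_le [NeZero n] (hP : Computes P N (H 0))
    (h : ∀ k : Fin n, 2 ≤ (k : ℕ) + 1 → Separates (k + 1) (U k) (V k) ((θ k : ℂ) ^ n))
    (w : State (parallelRegisters P (Fin n)) N → ℕ)
    (hw : ∀ ψ, w (exchangeEnd _ N ψ) = w ψ) (B : ℕ)
    (hB : ∀ β, (forward P (Fin n)).cost (tensorRep _ N) (exchangeEnd _ N) w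
      (idleState P (Fin n) N β) ≤ B) (a : (Fin n → Bool × Bool) → ℂ) :
    (weightOneSchedule P U V θ).cost (tensorRep _ N) (exchangeEnd _ N) w
      (idleState P (Fin n) N (cleanCoins a)) ≤ 6 * B := by
  rw [weightOneSchedule, Schedule.cost_seq, Schedule.cost_seq,
    Schedule.final_call _ (exchangeEnd_exchangeEnd _ N) _ _ (tensorRep_outputGate_forward hP h a),
    Schedule.cost_call _ (exchangeEnd_exchangeEnd _ N) w hw _ _
      (tensorRep_outputGate_forward hP h a),
    Schedule.cost_rev _ (exchangeEnd_exchangeEnd _ N) w hw]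
  have h1 := cost_coinSchedule_le U V θ hP w hw B hB a
  have h2 := cost_coinSchedule_le U V θ hP w hw B hB (applyWeightOne a)
  have h3 : ∀ a, (forward P (Fin n)).cost (tensorRep _ N) (exchangeEnd _ N) w
      ((coinSchedule P U V θ).final (tensorRep _ N) (exchangeEnd _ N)
          (idleState P (Fin n) N (cleanCoins a))) ≤ B := fun a => by
    rw [final_coinSchedule U V θ hP]
    exact hB _
  have h4 := h3 a
  have h5 := h3 (applyWeightOne a)
  omega

theorem computesCoherently_weightOne [NeZero n] (hP : Computes P N (H 0))
    (h : ∀ k : Fin n, 2 ≤ (k : ℕ) + 1 → Separates (k + 1) (U k) (V k) ((θ k : ℂ) ^ n)) :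
    ComputesCoherently ((parallelRegisters P (Fin n)).withSchedule (weightOneSchedule P U V θ)) N
      (H 1) := by
  intro α _
  refine (finalState_withSchedule (parallelRegisters P (Fin n)) (weightOneSchedule P U V θ) N
    (initialState (parallelRegisters P (Fin n)) N α)).trans ?_
  refine Eq.trans ?_ (cleanState_eq_idleState P N α (H 1)).symm
  rw [initialState, cleanState_eq_idleState, final_weightOneSchedule hP h]
  congr 2
  funext s
  simp only [applyWeightOne]
  cases H 1 fun v => (s v).1 <;> simp

theorem bitsOn_weightOne_le [NeZero n] (hP : Computes P N (H 0))
    (h : ∀ k : Fin n, 2 ≤ (k : ℕ) + 1 → Separates (k + 1) (U k) (V k) ((θ k : ℂ) ^ n))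
    (α α₀ : (Fin n → Bool) → ℂ)
    (h₀ : ∀ r < P.rounds, ∀ x, sent P N (Pi.single x 1) r ⊆ sent P N α₀ r) :
    bitsOn ((parallelRegisters P (Fin n)).withSchedule (weightOneSchedule P U V θ)) N α ≤
      12 * n * bitsOn P N α₀ := by
  rw [bitsOn_withSchedule, initialState, cleanState_eq_idleState]
  refine (cost_weightOneSchedule_le hP h _ (bitCost_exchangeEnd _ N) (2 * n * bitsOn P N α₀)
    (fun β => ?_) _).trans (le_of_eq (by ring))
  rw [cost_forward, bitsOn, Finset.mul_sum]
  refine Finset.sum_le_sum fun r hr => ?_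
  refine (card_usedCells_parallelState P (Fin n) N β r _
    (h₀ r (Finset.mem_range.1 hr))).trans (le_of_eq ?_)
  rw [Fintype.card_prod, Fintype.card_fin, Fintype.card_bool, mul_comm n 2]

theorem activeRoundsOn_weightOne_le [NeZero n] (hP : Computes P N (H 0))
    (h : ∀ k : Fin n, 2 ≤ (k : ℕ) + 1 → Separates (k + 1) (U k) (V k) ((θ k : ℂ) ^ n))
    (α α₀ : (Fin n → Bool) → ℂ)
    (h₀ : ∀ r < P.rounds, ∀ x, sent P N (Pi.single x 1) r ⊆ sent P N α₀ r) :
    activeRoundsOn ((parallelRegisters P (Fin n)).withSchedule (weightOneSchedule P U V θ)) N α ≤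
      6 * activeRoundsOn P N α₀ := by
  rw [activeRoundsOn_withSchedule, initialState, cleanState_eq_idleState]
  refine cost_weightOneSchedule_le hP h _ (roundCost_exchangeEnd _ N) _ (fun β => ?_) _
  rw [cost_forward, activeRoundsOn_eq_cost]
  refine Finset.sum_le_sum fun r hr => ?_
  have := card_usedCells_parallelState P (Fin n) N β r _ (h₀ r (Finset.mem_range.1 hr))
  rw [roundCost, roundCost, ← stateAfter_eq_run, ← sent_eq_usedCells]
  -- A round that is silent for `α₀` is silent for all copies. Any other round counts once on both
  -- sides, so the factor `2 n` does not enter.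
  rcases Nat.eq_zero_or_pos (sent P N α₀ r).card with h0 | h0
  · rw [h0, mul_zero] at this
    omega
  · omega

end Algorithm

theorem exists_coins (n : ℕ) : ∃ (U V : Fin n → unitaryGroup Bool ℂ) (θ : Fin n → Circle),
    ∀ k : Fin n, 2 ≤ (k : ℕ) + 1 → Separates (k + 1) (U k) (V k) ((θ k : ℂ) ^ n) := by
  have key : ∀ k : Fin n, ∃ (U V : unitaryGroup Bool ℂ) (θ : Circle),
      2 ≤ (k : ℕ) + 1 → Separates (k + 1) U V ((θ : ℂ) ^ n) := by
    intro k
    by_cases hk : 2 ≤ (k : ℕ) + 1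
    · obtain ⟨U, V, ω, h⟩ := exists_separates hk
      obtain ⟨θ, rfl⟩ := exists_circle_pow_eq ω (by have := k.2; omega : n ≠ 0)
      exact ⟨U, V, θ, fun _ => by simpa using h⟩
    -- Index `0` stands for weight one, where nothing has to be excluded, so any gates serve.
    · exact ⟨1, 1, 1, fun h => absurd h hk⟩
  choose U V θ h using key
  exact ⟨U, V, θ, h⟩

end AnonQNet

theorem theorem2 :
    ∃ C : ℕ, ∀ A₀ : AnonQNet.Algorithm, ∃ A₁ : AnonQNet.Algorithm, ∀ n : ℕ,
      (A₁ n).rounds ≤ C * (A₀ n).rounds ∧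
      ∀ N : AnonQNet.Network n, AnonQNet.Computes (A₀ n) N (AnonQNet.H 0) →
        AnonQNet.ComputesCoherently (A₁ n) N (AnonQNet.H 1) ∧
        AnonQNet.activeRoundComplexity (A₁ n) N ≤
          (C : ℕ∞) * AnonQNet.activeRoundComplexity (A₀ n) N ∧
        AnonQNet.bitComplexity (A₁ n) N ≤
          (C : ℕ∞) * (n : ℕ∞) * AnonQNet.bitComplexity (A₀ n) N := by
  choose U V θ h using AnonQNet.exists_coins
  -- Six runs of `2 n` copies give `12 n` for the qubits; for both counts of rounds `6` would
  -- suffice.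
  refine ⟨12, fun A₀ => ⟨fun n => (AnonQNet.parallelRegisters (A₀ n) (Fin n)).withSchedule
    (AnonQNet.weightOneSchedule (A₀ n) (U n) (V n) (θ n)), fun n => ⟨?_, fun N hN => ?_⟩⟩⟩
  · exact (AnonQNet.rounds_weightOneSchedule (A₀ n) (U n) (V n) (θ n)).le.trans (by omega)
  · have : NeZero n := ⟨fun h0 => by
      obtain ⟨v⟩ := N.connected.nonempty
      exact absurd v.2 (by omega)⟩
    obtain ⟨α₀, hα₀, h₀⟩ := AnonQNet.exists_generic_input (A₀ n) N
    refine ⟨AnonQNet.computesCoherently_weightOne hN (h n), iSup₂_le fun α _ => ?_,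
      iSup₂_le fun α _ => ?_⟩
    · refine le_trans ?_ (mul_le_mul_right (le_iSup₂_of_le α₀ hα₀ le_rfl) _)
      have := AnonQNet.activeRoundsOn_weightOne_le hN (h n) α α₀ h₀
      exact_mod_cast this.trans (Nat.mul_le_mul_right _ (by norm_num))
    · refine le_trans ?_ (mul_le_mul_right (le_iSup₂_of_le α₀ hα₀ le_rfl) _)
      exact_mod_cast AnonQNet.bitsOn_weightOne_le hN (h n) α α₀ h₀
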